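/- **Theorem (Refined strong maximum principle when $c$ has arbitrary sign).** Let $d\ge 1$, let $Q\subset\mathbb R^{d+1}$ be open, with points $P=(t,x)$, $t\in\mathbb R$, $x\in\mathbb R^d$, and let $a:Q\to\mathbb R^{d\times d}$ take values in the non-negative definite symmetric matrices. When $\partial Q$ has a tangent plane at $P$ with inward-pointing unit normal, write this normal as $(n_0(P),\vec n(P))\in\mathbb R\times\mathbb R^d$. Define the degenerate boundary $$\partial_0 Q:=\operatorname{Int}\Big\{P\in\partial Q:\lim_{Q\ni P'\to P}a(P')=0\Big\}\cap\operatorname{Int}\{P\in\partial Q: n_0(P)=0\}$$ (interiors relative to $\partial Q$), and $\underline Q:=Q\cup\partial_0Q$. Let $b$ be an $\mathbb R^d$-valued and $c$ a real-valued function on $\underline Q$, and put $a=0$ on $\partial_0Q$. Let $$Lu:=-u_t-\operatorname{tr}(aD^2u)-\langle b,Du\rangle+cu,$$ where $Du$, $D^2u$ are the gradient and Hessian in $x$. Assume: * $\partial_0Q$ is a boundary portion of class $C^{1,\alpha}$ for some $\alpha\in(0,1]$; * the lower semicontinuous envelope on $Q$ of the least eigenvalue of $a$ is positive on $Q$, and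 $a$ is locally bounded on $Q$; * $\langle b,\vec n\rangle>0$ on $\partial_0Q$; * $b$ and $c$ are locally bounded on $\underline Q$; * $a,b,c$, as functions on $\underline Q$, are continuous at every point of $\partial_0Q$. No sign condition is imposed on $c$. Let $u\in C^2_s(\underline Q)$, that is: $u,u_t,u_{x_i},u_{x_ix_j}$ exist and are continuous on $Q$; $u$ and $Du$ extend continuously to $\underline Q$ (and $u$ denotes its extension); $\operatorname{tr}(aD^2u)$ is continuous on $Q$ and extends continuously to $\underline Q$ with value $0$ on $\partial_0Q$. For $P^0\in\underline Q$ let $S(P^0)$ be the set of $P\in\underline Q$ which can be joined to $P^0$ by a simple continuous curve in $\underline Q$ along which the time coordinate is non-increasing from $P$ to $P^0$ (with $P^0\in S(P^0)$). If $Lu\le 0$ on $Q$, $u\le 0$ on $S(P^0)$ and $u(P^0)=0$ for some $P^0\in\underline Q$, then $u=0$ on $S(P^0)$. -/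

import Mathlib

open Set Filter Topology
open scoped NNReal

namespace DegenerateParabolic

/-- Space `ℝ^d`, with the Euclidean norm. -/
abbrev Space (d : ℕ) : Type := EuclideanSpace ℝ (Fin d)

/-- Space-time `ℝ^{d+1}`; points are pairs `(t, x)`. -/
abbrev SpaceTime (d : ℕ) : Type := ℝ × Space d

/-! ### Derivatives of a function of `(t, x)` -/

/-- The time derivative `u_t`. -/
noncomputable def timeDeriv {d : ℕ} (u : SpaceTime d → ℝ) (P : SpaceTime d) : ℝ :=
  deriv (fun s => u (s, P.2)) P.1

/-- The gradient `Du` in the spatial variables. -/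
noncomputable def spaceGrad {d : ℕ} (u : SpaceTime d → ℝ) (P : SpaceTime d) : Space d :=
  gradient (fun y => u (P.1, y)) P.2

/-- The Hessian matrix `D²u` in the spatial variables: entry `(i, j)` is the derivative of
`u_{x_i}` in the direction `e_j`. -/
noncomputable def spaceHess {d : ℕ} (u : SpaceTime d → ℝ) (P : SpaceTime d) :
    Matrix (Fin d) (Fin d) ℝ :=
  fun i j => (fderiv ℝ (fun y => spaceGrad u (P.1, y)) P.2 (EuclideanSpace.single j 1)) i

/-- The second-order term `tr(a D²u)`. -/
noncomputable def traceTerm {d : ℕ} (a : SpaceTime d → Matrix (Fin d) (Fin d) ℝ)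
    (u : SpaceTime d → ℝ) (P : SpaceTime d) : ℝ :=
  (a P * spaceHess u P).trace

/-- The operator `Lu = -u_t - tr(a D²u) - ⟨b, Du⟩ + c u`. -/
noncomputable def parabolicOp {d : ℕ} (a : SpaceTime d → Matrix (Fin d) (Fin d) ℝ)
    (b : SpaceTime d → Space d) (c : SpaceTime d → ℝ) (u : SpaceTime d → ℝ)
    (P : SpaceTime d) : ℝ :=
  -timeDeriv u P - traceTerm a u P - inner ℝ (b P) (spaceGrad u P) + c P * u P

/-! ### The degenerate boundary -/

/-- `ν = (ν₀, ν')` is the inward-pointing unit normal to `∂Q` at `P`: `∂Q` has at `P` the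
tangent plane orthogonal to `ν`, with `Q` on the side of `ν` and the complement of `Q` on the
other side. That is, for every `ε > 0` and all `P'` close to `P`, `P'` is in `Q` if
`⟨P' - P, ν⟩ > ε |P' - P|`, and is not in `Q` if `⟨P' - P, ν⟩ < -ε |P' - P|`. (The choice of the
norm `|P' - P|` is immaterial.) -/
def IsInwardNormal {d : ℕ} (Q : Set (SpaceTime d)) (P ν : SpaceTime d) : Prop :=
  ν.1 ^ 2 + ‖ν.2‖ ^ 2 = 1 ∧
  ∀ ε : ℝ, 0 < ε → ∀ᶠ P' in 𝓝 P,
    (ε * ‖P' - P‖ < (P'.1 - P.1) * ν.1 + inner ℝ (P'.2 - P.2) ν.2 → P' ∈ Q) ∧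
    ((P'.1 - P.1) * ν.1 + inner ℝ (P'.2 - P.2) ν.2 < -(ε * ‖P' - P‖) → P' ∉ Q)

/-- The interior of `{P ∈ ∂Q | p P}` relative to the topological boundary `∂Q`. -/
def boundaryInterior {d : ℕ} (Q : Set (SpaceTime d)) (p : SpaceTime d → Prop) :
    Set (SpaceTime d) :=
  {P | P ∈ frontier Q ∧ ∀ᶠ P' in 𝓝[frontier Q] P, p P'}

/-- The degenerate boundary `∂₀Q`: the set of boundary points near which, along `∂Q`,
the coefficient `a` tends to zero and the time component `n₀` of the normal vanishes. -/
def degBoundary {d : ℕ} (Q : Set (SpaceTime d)) (a : SpaceTime d → Matrix (Fin d) (Fin d) ℝ) :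
    Set (SpaceTime d) :=
  boundaryInterior Q (fun P => Tendsto a (𝓝[Q] P) (𝓝 0)) ∩
    boundaryInterior Q (fun P => ∃ ν, IsInwardNormal Q P ν ∧ ν.1 = 0)

/-- `Q` together with its degenerate boundary. -/
def underlineSet {d : ℕ} (Q : Set (SpaceTime d))
    (a : SpaceTime d → Matrix (Fin d) (Fin d) ℝ) : Set (SpaceTime d) :=
  Q ∪ degBoundary Q a

/-- The boundary portion `Σ ⊆ ∂Q` is of class `C^{1,α}`: near each of its points, `Q` is the
positivity set of a `C^{1,α}` function with nowhere vanishing differential. -/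
def IsC1AlphaPortion {d : ℕ} (Q S : Set (SpaceTime d)) (α : ℝ≥0) : Prop :=
  ∀ P ∈ S, ∃ (U : Set (SpaceTime d)) (ρ : SpaceTime d → ℝ) (K : ℝ≥0),
    IsOpen U ∧ P ∈ U ∧ ContDiffOn ℝ 1 ρ U ∧ HolderOnWith K α (fderiv ℝ ρ) U ∧
    (∀ P' ∈ U, fderiv ℝ ρ P' ≠ 0) ∧
    Q ∩ U = {P' ∈ U | 0 < ρ P'} ∧ frontier Q ∩ U = {P' ∈ U | ρ P' = 0}

/-! ### Function spaces -/

/-- Parabolic `C²(Q)`: `u`, `u_t`, `u_{x_i}`, `u_{x_i x_j}` exist and are continuous on `Q`. -/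
structure IsParabolicC2 {d : ℕ} (Q : Set (SpaceTime d)) (u : SpaceTime d → ℝ) : Prop where
  continuousOn : ContinuousOn u Q
  differentiable_time : ∀ P ∈ Q, DifferentiableAt ℝ (fun s => u (s, P.2)) P.1
  continuousOn_timeDeriv : ContinuousOn (timeDeriv u) Q
  differentiable_space : ∀ P ∈ Q, DifferentiableAt ℝ (fun y => u (P.1, y)) P.2
  continuousOn_spaceGrad : ContinuousOn (spaceGrad u) Q
  differentiable_spaceGrad : ∀ P ∈ Q, DifferentiableAt ℝ (fun y => spaceGrad u (P.1, y)) P.2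
  continuousOn_spaceHess : ContinuousOn (spaceHess u) Q

/-- The space `C²_s` on `Q ∪ ∂₀Q`: functions in `C²(Q)` which are `C¹` up to `∂₀Q` (that is,
`u` and `Du` are continuous up to `∂₀Q`), and for which `tr(a D²u)` is continuous up to `∂₀Q`
with boundary values zero. -/
structure IsC2s {d : ℕ} (Q : Set (SpaceTime d)) (a : SpaceTime d → Matrix (Fin d) (Fin d) ℝ)
    (u : SpaceTime d → ℝ) : Prop where
  isParabolicC2 : IsParabolicC2 Q u
  continuousOn : ContinuousOn u (underlineSet Q a)
  exists_grad : ∃ G : SpaceTime d → Space d,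
    ContinuousOn G (underlineSet Q a) ∧ EqOn G (spaceGrad u) Q
  exists_trace : ∃ g : SpaceTime d → ℝ,
    ContinuousOn g (underlineSet Q a) ∧ EqOn g (traceTerm a u) Q ∧ ∀ P ∈ degBoundary Q a, g P = 0

/-! ### Conditions on the coefficients -/

/-- The smallest eigenvalue of a symmetric matrix. -/
noncomputable def leastEigenvalue {d : ℕ} (A : Matrix (Fin d) (Fin d) ℝ) : ℝ :=
  sInf (spectrum ℝ A)

/-- The lower semicontinuous envelope on `Q` of a function on `Q`, at a point of `Q`. -/
noncomputable def lscEnvelope {d : ℕ} (Q : Set (SpaceTime d)) (f : SpaceTime d → ℝ)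
    (P : SpaceTime d) : ℝ :=
  liminf f (𝓝[Q] P)

/-- `f` is locally bounded on `S`. -/
def LocallyBoundedOn {d : ℕ} {E : Type*} [Norm E] (f : SpaceTime d → E)
    (S : Set (SpaceTime d)) : Prop :=
  ∀ P ∈ S, ∃ K : ℝ, ∀ᶠ P' in 𝓝[S] P, ‖f P'‖ ≤ K

/-- The hypotheses on the domain `Q` and the coefficients `a`, `b`, `c`. The values of `b` and
`c` (and `a`) at points of `∂₀Q` are those of their continuous extensions. -/
structure Hypotheses {d : ℕ} (Q : Set (SpaceTime d)) (α : ℝ≥0)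
    (a : SpaceTime d → Matrix (Fin d) (Fin d) ℝ) (b : SpaceTime d → Space d)
    (c : SpaceTime d → ℝ) : Prop where
  isOpen : IsOpen Q
  boundary_c1alpha : IsC1AlphaPortion Q (degBoundary Q a) α
  a_posSemidef : ∀ P ∈ Q, (a P).PosSemidef
  a_strictlyParabolic : ∀ P ∈ Q, 0 < lscEnvelope Q (fun P' => leastEigenvalue (a P')) P
  a_locallyBounded : ∀ i j, LocallyBoundedOn (fun P => a P i j) Q
  b_normal_pos : ∀ P ∈ degBoundary Q a, ∀ ν, IsInwardNormal Q P ν → 0 < inner ℝ (b P) ν.2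
  b_locallyBounded : LocallyBoundedOn b (underlineSet Q a)
  c_locallyBounded : LocallyBoundedOn c (underlineSet Q a)
  a_continuous : ∀ P ∈ degBoundary Q a, ContinuousWithinAt a (underlineSet Q a) P
  b_continuous : ∀ P ∈ degBoundary Q a, ContinuousWithinAt b (underlineSet Q a) P
  c_continuous : ∀ P ∈ degBoundary Q a, ContinuousWithinAt c (underlineSet Q a) P

/-- The set `S(P⁰)` inside `X = Q ∪ ∂₀Q`: all `P ∈ X` joined to `P⁰` by a simple continuous curve
in `X` along which the time coordinate is non-increasing from `P` to `P⁰`. The case `r = 0`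
(the constant curve) puts `P⁰` itself into the set. -/
def reachSet {d : ℕ} (X : Set (SpaceTime d)) (P₀ : SpaceTime d) : Set (SpaceTime d) :=
  {P | ∃ (r : ℝ) (γ : ℝ → SpaceTime d), 0 ≤ r ∧ ContinuousOn γ (Icc 0 r) ∧
    InjOn γ (Icc 0 r) ∧ MapsTo γ (Icc 0 r) X ∧ AntitoneOn (fun s => (γ s).1) (Icc 0 r) ∧
    γ 0 = P ∧ γ r = P₀}

end DegenerateParabolic

namespace DegenerateParabolic

variable {d : ℕ}

/-! ### Reachability -/

theorem reachSet_refl {X : Set (SpaceTime d)} {P : SpaceTime d} (hP : P ∈ X) :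
    P ∈ reachSet X P :=
  ⟨0, fun _ => P, le_rfl, continuousOn_const,
    fun x hx y hy _ => by
      simp only [Icc_self, mem_singleton_iff] at hx hy
      rw [hx, hy],
    fun _ _ => hP, fun _ _ _ _ _ => le_rfl, rfl, rfl⟩

theorem reachSet_mono {X Y : Set (SpaceTime d)} (h : X ⊆ Y) (P : SpaceTime d) :
    reachSet X P ⊆ reachSet Y P := by
  rintro _ ⟨r, γ, h0, h1, h2, h3, h4, h5, h6⟩
  exact ⟨r, γ, h0, h1, h2, h3.mono_right h, h4, h5, h6⟩

theorem reachSet_of_segment {X : Set (SpaceTime d)} {P R : SpaceTime d}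
    (h : segment ℝ P R ⊆ X) (ht : R.1 ≤ P.1) : P ∈ reachSet X R := by
  by_cases hPR : P = R
  · subst hPR
    exact reachSet_refl (h (left_mem_segment ℝ P P))
  refine ⟨1, fun s => AffineMap.lineMap P R s, zero_le_one,
    AffineMap.lineMap_continuous.continuousOn, (AffineMap.lineMap_injective ℝ hPR).injOn,
    fun s hs => h ?_, ?_, AffineMap.lineMap_apply_zero _ _, AffineMap.lineMap_apply_one _ _⟩
  · rw [segment_eq_image_lineMap]
    exact mem_image_of_mem _ hs
  · intro s _ s' _ hss
    simp only [AffineMap.lineMap_apply_module, Prod.fst_add, Prod.smul_fst, smul_eq_mul]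
    nlinarith

/-- The points of a simple monotone curve ending at `R` are all joined to `R`. -/
theorem mem_reachSet_of_curve {X : Set (SpaceTime d)} {r : ℝ} {γ : ℝ → SpaceTime d}
    (h1 : ContinuousOn γ (Icc 0 r)) (h2 : InjOn γ (Icc 0 r)) (h3 : MapsTo γ (Icc 0 r) X)
    (h4 : AntitoneOn (fun s => (γ s).1) (Icc 0 r)) {s : ℝ} (hs : s ∈ Icc 0 r) :
    γ s ∈ reachSet X (γ r) := by
  have hsub : ∀ x ∈ Icc 0 (r - s), x + s ∈ Icc 0 r := fun x hx =>
    ⟨by linarith [hx.1, hs.1], by linarith [hx.2]⟩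
  refine ⟨r - s, fun x => γ (x + s), by linarith [hs.2], ?_, ?_, ?_, ?_, by simp, by simp⟩
  · exact h1.comp (by fun_prop) hsub
  · intro x hx y hy hxy
    simpa using h2 (hsub x hx) (hsub y hy) hxy
  · exact fun x hx => h3 (hsub x hx)
  · intro x hx y hy hxy
    exact h4 (hsub x hx) (hsub y hy) (by linarith)

/-- Plain concatenation may destroy injectivity. Cutting the first curve where it first meets the
second, and continuing from that point of the second, keeps the curve simple. -/
theorem reachSet_trans {X : Set (SpaceTime d)} {P R S : SpaceTime d}
    (hPR : P ∈ reachSet X R) (hRS : R ∈ reachSet X S) : P ∈ reachSet X S := by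
  obtain ⟨r, γ, r0, γc, γi, γX, γt, γ0, γr⟩ := hPR
  obtain ⟨q, η, q0, ηc, ηi, ηX, ηt, η0, ηq⟩ := hRS
  -- first time at which `γ` meets the image of `η`
  set T : Set ℝ := Icc 0 r ∩ γ ⁻¹' (η '' Icc 0 q) with hT
  have hKc : IsCompact (η '' Icc 0 q) := isCompact_Icc.image_of_continuousOn ηc
  have hTc : IsCompact T :=
    isCompact_Icc.of_isClosed_subset (γc.preimage_isClosed_of_isClosed isClosed_Icc hKc.isClosed)
      inter_subset_left
  have hTne : T.Nonempty := ⟨r, right_mem_Icc.2 r0, ⟨0, left_mem_Icc.2 q0, by rw [η0, γr]⟩⟩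
  obtain ⟨σ, ⟨hσ, ⟨τ, hτ, hτσ⟩⟩, hmin⟩ := hTc.exists_isLeast hTne
  have hηm : ∀ x, σ ≤ x → x ≤ σ + (q - τ) → x - σ + τ ∈ Icc 0 q := fun x h h' =>
    ⟨by linarith [hτ.1], by linarith⟩
  have hγm : ∀ x, 0 ≤ x → x ≤ σ → x ∈ Icc 0 r := fun x h h' => ⟨h, h'.trans hσ.2⟩
  set ζ : ℝ → SpaceTime d := fun x => if x ≤ σ then γ x else η (x - σ + τ) with hζ
  have ζ1 : ∀ x, x ≤ σ → ζ x = γ x := fun x hx => by simp [hζ, hx]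
  have ζ2 : ∀ x, σ ≤ x → ζ x = η (x - σ + τ) := fun x hx => by
    rcases hx.eq_or_lt with rfl | hx
    · simp [hζ, hτσ]
    · simp [hζ, not_le.2 hx]
  have hcross : ∀ x ∈ Icc 0 (σ + (q - τ)), ∀ y ∈ Icc 0 (σ + (q - τ)), x ≤ σ → σ < y →
      ζ x ≠ ζ y := by
    intro x hx y hy hxσ hy' h
    rw [ζ1 x hxσ, ζ2 y hy'.le] at h
    have hxT : x ∈ T := ⟨hγm x hx.1 hxσ, ⟨y - σ + τ, hηm y hy'.le hy.2, h.symm⟩⟩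
    have : x = σ := le_antisymm hxσ (hmin hxT)
    subst this
    rw [← hτσ] at h
    have := ηi hτ (hηm y hy'.le hy.2) h
    linarith
  refine ⟨σ + (q - τ), ζ, by linarith [hσ.1, hτ.2], ?_, ?_, ?_, ?_, by rw [ζ1 0 hσ.1, γ0], ?_⟩
  · have hu : Icc 0 (σ + (q - τ)) = Icc 0 σ ∪ Icc σ (σ + (q - τ)) :=
      (Icc_union_Icc_eq_Icc hσ.1 (by linarith [hτ.2])).symm
    rw [hu]
    refine ContinuousOn.union_of_isClosed ?_ ?_ isClosed_Icc isClosed_Icc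
    · exact (γc.mono fun x hx => hγm x hx.1 hx.2).congr fun x hx => ζ1 x hx.2
    · exact (ηc.comp (f := fun x => x - σ + τ) (by fun_prop) fun x hx => hηm x hx.1 hx.2).congr
        fun x hx => ζ2 x hx.1
  · intro x hx y hy hxy
    rcases le_or_gt x σ with h1 | h1 <;> rcases le_or_gt y σ with h2 | h2
    · rw [ζ1 x h1, ζ1 y h2] at hxy
      exact γi (hγm x hx.1 h1) (hγm y hy.1 h2) hxy
    · exact absurd hxy (hcross x hx y hy h1 h2)
    · exact absurd hxy.symm (hcross y hy x hx h2 h1)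
    · rw [ζ2 x h1.le, ζ2 y h2.le] at hxy
      have := ηi (hηm x h1.le hx.2) (hηm y h2.le hy.2) hxy
      linarith
  · intro x hx
    rcases le_or_gt x σ with h1 | h1
    · rw [ζ1 x h1]; exact γX (hγm x hx.1 h1)
    · rw [ζ2 x h1.le]; exact ηX (hηm x h1.le hx.2)
  · intro x hx y hy hxy
    have hA : ∀ x ∈ Icc 0 (σ + (q - τ)), ∀ y ∈ Icc 0 (σ + (q - τ)), x ≤ y → y ≤ σ →
        (ζ y).1 ≤ (ζ x).1 := fun x hx y hy hxy h => by
      rw [ζ1 x (hxy.trans h), ζ1 y h]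
      exact γt (hγm x hx.1 (hxy.trans h)) (hγm y hy.1 h) hxy
    have hB : ∀ x ∈ Icc 0 (σ + (q - τ)), ∀ y ∈ Icc 0 (σ + (q - τ)), x ≤ y → σ ≤ x →
        (ζ y).1 ≤ (ζ x).1 := fun x hx y hy hxy h => by
      rw [ζ2 x h, ζ2 y (h.trans hxy)]
      exact ηt (hηm x h hx.2) (hηm y (h.trans hxy) hy.2) (by linarith)
    have hσm : σ ∈ Icc 0 (σ + (q - τ)) := ⟨hσ.1, by linarith [hτ.2]⟩
    rcases le_or_gt y σ with h2 | h2
    · exact hA x hx y hy hxy h2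
    rcases le_or_gt x σ with h1 | h1
    · exact (hB σ hσm y hy h2.le le_rfl).trans (hA x hx σ hσm h1 le_rfl)
    · exact hB x hx y hy hxy h1.le
  · rw [ζ2 _ (by linarith [hτ.2])]
    rw [show σ + (q - τ) - σ + τ = q by ring, ηq]

/-- Local propagation of zeros at all points of `Y` gives propagation along curves in `Y`. -/
theorem eq_zero_of_mem_reachSet {X Y : Set (SpaceTime d)} (hYX : Y ⊆ X) {u : SpaceTime d → ℝ}
    (hc : ContinuousOn u X) {P₀ : SpaceTime d}
    (hloc : ∀ z ∈ Y, z ∈ reachSet X P₀ → u z = 0 →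
      ∀ᶠ P in 𝓝 z, P ∈ Y → z.1 ≤ P.1 → u P = 0)
    {z : SpaceTime d} (hz : z ∈ reachSet X P₀) (huz : u z = 0)
    {P : SpaceTime d} (hP : P ∈ reachSet Y z) : u P = 0 := by
  obtain ⟨r, γ, r0, γc, γi, γY, γt, γ0, γr⟩ := hP
  -- Continuous induction from the endpoint `z`: the set of zeros is closed in the parameter, and
  -- `hloc` extends it to the right because time increases when the curve is reversed.
  have key : Icc 0 r ⊆ {s | u (γ (r - s)) = 0} := by
    have hm : ∀ s ∈ Icc 0 r, r - s ∈ Icc 0 r := fun s hs =>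
      ⟨by linarith [hs.2], by linarith [hs.1]⟩
    have hcont : ContinuousOn (fun s => u (γ (r - s))) (Icc 0 r) :=
      hc.comp (γc.comp (by fun_prop) hm) fun s hs => hYX (γY (hm s hs))
    refine IsClosed.Icc_subset_of_forall_mem_nhdsWithin ?_ (by simp [γr, huz]) ?_
    · rw [inter_comm]
      exact hcont.preimage_isClosed_of_isClosed isClosed_Icc (isClosed_singleton (x := (0 : ℝ)))
    · rintro s ⟨hs, hs'⟩
      have hsI : s ∈ Icc 0 r := ⟨hs'.1, hs'.2.le⟩
      have hreach : γ (r - s) ∈ reachSet X P₀ := by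
        refine reachSet_trans (reachSet_mono hYX _ ?_) hz
        rw [← γr]
        exact mem_reachSet_of_curve γc γi γY γt (hm s hsI)
      have hl := hloc _ (γY (hm s hsI)) hreach hs
      have hct : Tendsto (fun x => γ (r - x)) (𝓝[Icc 0 r] s) (𝓝 (γ (r - s))) :=
        (γc.comp (f := fun x => r - x) (by fun_prop) hm) s hsI
      have hnb : 𝓝[>] s ≤ 𝓝[Icc 0 r] s := by
        rw [← nhdsWithin_Ioo_eq_nhdsGT hs'.2]
        exact nhdsWithin_mono _ fun x hx => ⟨hs'.1.trans hx.1.le, hx.2.le⟩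
      filter_upwards [(hct.mono_left hnb).eventually hl, Ioo_mem_nhdsGT hs'.2] with x hx hx'
      have hxI : x ∈ Icc 0 r := ⟨hs'.1.trans hx'.1.le, hx'.2.le⟩
      exact hx (γY (hm x hxI)) (γt (hm x hxI) (hm s hsI) (by linarith [hx'.1]))
  have := key (right_mem_Icc.2 r0)
  simpa [γ0] using this

/-! ### Pointwise consequences of a maximum -/

/-- A positive second derivative would make the point a local minimum as well, so `f` would be
locally constant and its second derivative zero. -/
theorem _root_.IsLocalMax.second_deriv_nonpos {f f' : ℝ → ℝ} {f'' x : ℝ} (hmax : IsLocalMax f x)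
    (hf : ∀ᶠ s in 𝓝 x, HasDerivAt f (f' s) s) (hf' : HasDerivAt f' f'' x) : f'' ≤ 0 := by
  by_contra! hpos
  have hd : deriv f =ᶠ[𝓝 x] f' := hf.mono fun s hs => hs.deriv
  have hdd : deriv (deriv f) x = f'' := (hf'.congr_of_eventuallyEq hd).deriv
  have hmin : IsLocalMin f x := isLocalMin_of_deriv_deriv_pos (hdd ▸ hpos)
    hmax.deriv_eq_zero hf.self_of_nhds.continuousAt
  have hconst : f =ᶠ[𝓝 x] fun _ => f x := by
    filter_upwards [hmin, hmax] with s h1 h2 using le_antisymm h2 h1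
  have : deriv f =ᶠ[𝓝 x] fun _ => 0 := by
    filter_upwards [hconst.eventuallyEq_nhds] with s hs
    rw [hs.deriv_eq, deriv_const]
  rw [this.deriv_eq, deriv_const] at hdd
  exact hpos.ne hdd

/-- Only later times are compared, since the maximum point may lie on the initial time slice of the
comparison region. -/
theorem nonpos_of_hasDerivAt_of_forall_ge {f : ℝ → ℝ} {f' x : ℝ} (hf : HasDerivAt f f' x)
    (hmax : ∀ᶠ s in 𝓝 x, x ≤ s → f s ≤ f x) : f' ≤ 0 := by
  by_contra! hpos
  have h := (hasDerivAt_iff_tendsto_slope.1 hf).eventually (lt_mem_nhds hpos)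
  have h2 : ∀ᶠ s in 𝓝[>] x, 0 < slope f x s :=
    h.filter_mono (nhdsWithin_mono _ fun s hs => ne_of_gt hs)
  obtain ⟨s, hs1, hs2, hs3⟩ :=
    (h2.and ((hmax.filter_mono nhdsWithin_le_nhds).and self_mem_nhdsWithin)).exists
  rw [slope_def_field] at hs1
  have hs3' : x < s := hs3
  have := hs2 hs3'.le
  have : (f s - f x) / (s - x) ≤ 0 := div_nonpos_of_nonpos_of_nonneg (by linarith) (by linarith)
  linarith

-- Writing `A = Bᵀ B` turns the sum into `∑ₖ ⟨L Bₖ, Bₖ⟩` over the rows of `B`. No symmetry of `L` is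
-- needed, so the Hessian need not be known to be symmetric.
open scoped MatrixOrder in
theorem sum_mul_nonpos_of_posSemidef {A : Matrix (Fin d) (Fin d) ℝ} (hA : A.PosSemidef)
    (L : Space d →L[ℝ] Space d) (hL : ∀ ξ, inner ℝ (L ξ) ξ ≤ 0) :
    ∑ i, ∑ j, A i j * (L (EuclideanSpace.single i 1)) j ≤ 0 := by
  obtain ⟨B, hB⟩ := CStarAlgebra.nonneg_iff_eq_star_mul_self.mp hA.nonneg
  have hsum : ∀ k, inner ℝ (L (WithLp.toLp 2 (B k))) (WithLp.toLp 2 (B k)) =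
      ∑ i, ∑ j, B k i * B k j * (L (EuclideanSpace.single i 1)) j := by
    intro k
    have h1 : (WithLp.toLp 2 (B k) : Space d) = ∑ i, B k i • EuclideanSpace.single i (1 : ℝ) := by
      ext j
      simp [Finset.sum_apply, Pi.single_apply]
    have h2 : ∀ j, (L (WithLp.toLp 2 (B k))) j =
        ∑ i, B k i * (L (EuclideanSpace.single i 1)) j := by
      intro j
      rw [h1, map_sum]
      simp
    rw [PiLp.inner_apply]
    simp only [h2, RCLike.inner_apply, conj_trivial, Finset.mul_sum]
    rw [Finset.sum_comm]
    refine Finset.sum_congr rfl fun i _ => Finset.sum_congr rfl fun j _ => by ring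
  have : ∑ i, ∑ j, A i j * (L (EuclideanSpace.single i 1)) j =
      ∑ k, inner ℝ (L (WithLp.toLp 2 (B k))) (WithLp.toLp 2 (B k)) := by
    simp only [hsum]
    symm
    rw [Finset.sum_comm]
    refine Finset.sum_congr rfl fun i _ => ?_
    rw [Finset.sum_comm]
    refine Finset.sum_congr rfl fun j _ => ?_
    rw [← Finset.sum_mul, hB]
    simp [Matrix.mul_apply, Matrix.star_eq_conjTranspose]
  rw [this]
  exact Finset.sum_nonpos fun k _ => hL _

theorem traceTerm_eq_sum (a : SpaceTime d → Matrix (Fin d) (Fin d) ℝ) (u : SpaceTime d → ℝ)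
    (P : SpaceTime d) : traceTerm a u P = ∑ i, ∑ j, a P i j *
      (fderiv ℝ (fun y => spaceGrad u (P.1, y)) P.2 (EuclideanSpace.single i 1)) j := by
  simp [traceTerm, Matrix.trace, Matrix.mul_apply, spaceHess]

/-- First and second order conditions at a maximum point of `u + G` among the points with larger
time coordinate. -/
theorem derivatives_le_of_max {Q : Set (SpaceTime d)} (hQ : IsOpen Q)
    {a : SpaceTime d → Matrix (Fin d) (Fin d) ℝ} {u : SpaceTime d → ℝ} (hu : IsParabolicC2 Q u)
    {P : SpaceTime d} (hP : P ∈ Q) (ha : (a P).PosSemidef) {G : SpaceTime d → ℝ} {G' : ℝ}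
    {g : Space d → Space d} {H : Space d →L[ℝ] Space d}
    (hGt : HasDerivAt (fun s => G (s, P.2)) G' P.1)
    (hGx : ∀ y, HasGradientAt (fun y => G (P.1, y)) (g y) y) (hGH : HasFDerivAt g H P.2)
    (hmax : ∀ᶠ R in 𝓝 P, P.1 ≤ R.1 → u R + G R ≤ u P + G P) :
    timeDeriv u P ≤ -G' ∧ spaceGrad u P = -g P.2 ∧
      traceTerm a u P ≤ -∑ i, ∑ j, a P i j * (H (EuclideanSpace.single i 1)) j := by
  have hxt : Tendsto (fun y : Space d => ((P.1, y) : SpaceTime d)) (𝓝 P.2) (𝓝 P) := by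
    have : Continuous fun y : Space d => ((P.1, y) : SpaceTime d) := by fun_prop
    simpa using this.tendsto P.2
  have htt : Tendsto (fun s : ℝ => ((s, P.2) : SpaceTime d)) (𝓝 P.1) (𝓝 P) := by
    have : Continuous fun s : ℝ => ((s, P.2) : SpaceTime d) := by fun_prop
    simpa using this.tendsto P.1
  have hgrad : ∀ y, ((P.1, y) : SpaceTime d) ∈ Q →
      HasGradientAt (fun y => u (P.1, y)) (spaceGrad u (P.1, y)) y := fun y hy =>
    (hu.differentiable_space _ hy).hasGradientAt
  have hxmax : IsLocalMax (fun y => u (P.1, y) + G (P.1, y)) P.2 :=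
    (hxt.eventually hmax).mono fun y hy => hy le_rfl
  refine ⟨?_, ?_, ?_⟩
  · have h1 := (hu.differentiable_time P hP).hasDerivAt.add hGt
    have := nonpos_of_hasDerivAt_of_forall_ge h1 (htt.eventually hmax)
    have e : timeDeriv u P = deriv (fun s => u (s, P.2)) P.1 := rfl
    linarith
  · have h1 := (hgrad P.2 hP).hasFDerivAt.add (hGx P.2).hasFDerivAt
    have h2 := hxmax.hasFDerivAt_eq_zero h1
    rw [← map_add] at h2
    have h3 := (InnerProductSpace.toDual ℝ (Space d)).map_eq_zero_iff.1 h2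
    exact eq_neg_of_add_eq_zero_left h3
  · set A := fderiv ℝ (fun y => spaceGrad u (P.1, y)) P.2 with hA
    have hAd : HasFDerivAt (fun y => spaceGrad u (P.1, y)) A P.2 :=
      (hu.differentiable_spaceGrad P hP).hasFDerivAt
    -- The quadratic form is read off as the second derivative of `u + G` along the spatial line in
    -- direction `ξ`.
    have hneg : ∀ ξ, inner ℝ ((A + H) ξ) ξ ≤ 0 := by
      intro ξ
      have hline : ∀ s : ℝ, HasDerivAt (fun s : ℝ => P.2 + s • ξ) ξ s := fun s => by
        simpa using ((hasDerivAt_id s).smul_const ξ).const_add P.2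
      have hl0 : Tendsto (fun s : ℝ => P.2 + s • ξ) (𝓝 0) (𝓝 P.2) := by
        simpa using (hline 0).continuousAt.tendsto
      have hmax' : IsLocalMax (fun s : ℝ => u (P.1, P.2 + s • ξ) + G (P.1, P.2 + s • ξ)) 0 := by
        filter_upwards [hl0.eventually hxmax] with s hs
        simpa using hs
      refine hmax'.second_deriv_nonpos
        (f' := fun s => inner ℝ (spaceGrad u (P.1, P.2 + s • ξ) + g (P.2 + s • ξ)) ξ) ?_ ?_
      · filter_upwards [hl0.eventually (hxt.eventually (hQ.mem_nhds hP))] with s hs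
        have h1 := ((hgrad _ hs).hasFDerivAt.add (hGx _).hasFDerivAt).comp_hasDerivAt s (hline s)
        simpa [inner_add_left] using! h1
      · have h0 : HasFDerivAt (fun y => spaceGrad u (P.1, y) + g y) (A + H)
            (P.2 + (0 : ℝ) • ξ) := by
          simpa using! hAd.add hGH
        have h1 := h0.comp_hasDerivAt (0 : ℝ) (hline 0)
        simpa using h1.inner ℝ (hasDerivAt_const (0 : ℝ) ξ)
    have := sum_mul_nonpos_of_posSemidef ha (A + H) hneg
    simp only [add_apply, PiLp.add_apply, mul_add,
      Finset.sum_add_distrib] at this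
    rw [traceTerm_eq_sum]
    linarith

/-- Parabolic `C²` functions are differentiable in space-time. -/
theorem IsParabolicC2.hasFDerivAt {Q : Set (SpaceTime d)} (hQ : IsOpen Q) {u : SpaceTime d → ℝ}
    (hu : IsParabolicC2 Q u) {P : SpaceTime d} (hP : P ∈ Q) :
    ∃ L : SpaceTime d →L[ℝ] ℝ, HasFDerivAt u L P ∧
      ∀ v, L v = v.1 * timeDeriv u P + inner ℝ (spaceGrad u P) v.2 := by
  have h := hasStrictFDerivAt_uncurry_coprod (𝕜 := ℝ) (u := P) (f := fun t x => u (t, x))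
    (f₁ := fun t x => ContinuousLinearMap.toSpanSingleton ℝ (timeDeriv u (t, x)))
    (f₂ := fun t x => InnerProductSpace.toDual ℝ (Space d) (spaceGrad u (t, x)))
    (by
      filter_upwards [hQ.mem_nhds hP] with v hv
      exact (hu.differentiable_time v hv).hasDerivAt.hasFDerivAt)
    (by
      filter_upwards [hQ.mem_nhds hP] with v hv
      exact (hu.differentiable_space v hv).hasGradientAt.hasFDerivAt)
    (by
      have h1 : ContinuousAt (timeDeriv u) P :=
        hu.continuousOn_timeDeriv.continuousAt (hQ.mem_nhds hP)
      have h2 : Continuous fun c : ℝ => ContinuousLinearMap.toSpanSingleton ℝ c :=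
        (ContinuousLinearMap.toSpanSingletonCLE (𝕜 := ℝ) (E := ℝ)).continuous
      exact h2.continuousAt.comp h1)
    (by
      have h1 : ContinuousAt (spaceGrad u) P :=
        hu.continuousOn_spaceGrad.continuousAt (hQ.mem_nhds hP)
      exact (InnerProductSpace.toDual ℝ (Space d)).continuous.continuousAt.comp h1)
  refine ⟨_, h.hasFDerivAt, fun v => ?_⟩
  simp [Function.HasUncurry.uncurry]

/-- A lower bound for the spectrum of a symmetric matrix bounds its quadratic form from below. -/
theorem le_quadForm_of_le_leastEigenvalue {A : Matrix (Fin d) (Fin d) ℝ} (hA : A.PosSemidef)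
    {l : ℝ} (hl : l ≤ leastEigenvalue A) (y : Space d) :
    l * ‖y‖ ^ 2 ≤ ∑ i, ∑ j, A i j * (y i * y j) := by
  have hherm : (A - l • (1 : Matrix (Fin d) (Fin d) ℝ)).IsHermitian := by
    refine hA.1.sub ?_
    simp [Matrix.IsHermitian]
  have hps : (A - l • (1 : Matrix (Fin d) (Fin d) ℝ)).PosSemidef := by
    rw [Matrix.posSemidef_iff_isHermitian_and_spectrum_nonneg]
    refine ⟨hherm, fun x hx => ?_⟩
    have hx' : x + l ∈ spectrum ℝ A := by
      have := spectrum.add_mem_iff (R := ℝ) (a := A) (r := x) (s := l)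
      rw [← Algebra.algebraMap_eq_smul_one, sub_eq_neg_add] at hx
      rw [this]
      simpa using hx
    have hbd : BddBelow (spectrum ℝ A) := ⟨0, fun y hy =>
      (Matrix.posSemidef_iff_isHermitian_and_spectrum_nonneg.1 hA).2 hy⟩
    have := csInf_le hbd hx'
    have h2 : l ≤ x + l := hl.trans this
    simpa using h2
  have h := hps.dotProduct_mulVec_nonneg (y : Fin d → ℝ)
  have e : ‖y‖ ^ 2 = ∑ i, y i * y i := by
    rw [EuclideanSpace.real_norm_sq_eq]
    exact Finset.sum_congr rfl fun i _ => by ring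
  rw [Matrix.sub_mulVec, dotProduct_sub, Matrix.smul_mulVec, Matrix.one_mulVec,
    dotProduct_smul] at h
  have e1 : star (y : Fin d → ℝ) ⬝ᵥ (A.mulVec y) = ∑ i, ∑ j, A i j * (y i * y j) := by
    simp only [dotProduct, Matrix.mulVec, Finset.mul_sum]
    refine Finset.sum_congr rfl fun i _ => Finset.sum_congr rfl fun j _ => ?_
    simp only [star_trivial]; ring
  have e2 : star (y : Fin d → ℝ) ⬝ᵥ (y : Fin d → ℝ) = ‖y‖ ^ 2 := by
    rw [e]; simp [dotProduct]
  rw [e1, e2, smul_eq_mul] at h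
  linarith

/-! ### The interior -/

/-- The real `liminf` is a supremum of eventual lower bounds. Its value for an empty set is `0`, so
positivity guarantees that such bounds exist, one of them positive. -/
theorem exists_pos_eventually_le_of_pos_liminf {β : Type*} {F : Filter β} {f : β → ℝ}
    (h : 0 < liminf f F) : ∃ l : ℝ, 0 < l ∧ ∀ᶠ x in F, l ≤ f x := by
  rw [liminf_eq] at h
  have hne : {a : ℝ | ∀ᶠ n in F, a ≤ f n}.Nonempty := by
    by_contra hne
    rw [not_nonempty_iff_eq_empty.1 hne, Real.sSup_empty] at h
    exact h.false
  obtain ⟨l, hl, hpos⟩ := exists_lt_of_lt_csSup hne h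
  exact ⟨l, hpos, hl⟩

theorem Hypotheses.exists_interior_bounds {Q : Set (SpaceTime d)} {α : ℝ≥0}
    {a : SpaceTime d → Matrix (Fin d) (Fin d) ℝ} {b : SpaceTime d → Space d}
    {c : SpaceTime d → ℝ} (hL : Hypotheses Q α a b c) {z : SpaceTime d} (hz : z ∈ Q) :
    ∃ l C : ℝ, 0 < l ∧ 0 ≤ C ∧ ∀ᶠ P in 𝓝 z, P ∈ Q ∧
      (∀ y : Space d, l * ‖y‖ ^ 2 ≤ ∑ i, ∑ j, a P i j * (y i * y j)) ∧
      ∑ i, a P i i ≤ C ∧ ‖b P‖ ≤ C ∧ |c P| ≤ C := by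
  have hQz : 𝓝[Q] z = 𝓝 z := hL.isOpen.nhdsWithin_eq hz
  have hzX : z ∈ underlineSet Q a := Or.inl hz
  have hXz : 𝓝[underlineSet Q a] z = 𝓝 z :=
    nhdsWithin_eq_nhds.2 (mem_of_superset (hL.isOpen.mem_nhds hz) subset_union_left)
  obtain ⟨l, hl0, hl⟩ := exists_pos_eventually_le_of_pos_liminf (hL.a_strictlyParabolic z hz)
  choose K hK using fun i => hL.a_locallyBounded i i z hz
  obtain ⟨B, hB⟩ := hL.b_locallyBounded z hzX
  obtain ⟨C, hC⟩ := hL.c_locallyBounded z hzX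
  rw [hQz] at hl
  simp only [hQz] at hK
  rw [hXz] at hB hC
  refine ⟨l, max (∑ i, K i) (max B (max C 0)), hl0, by simp, ?_⟩
  filter_upwards [hl, eventually_all.2 hK, hB, hC, hL.isOpen.mem_nhds hz] with P h1 h2 h3 h4 h5
  refine ⟨h5, fun y => le_quadForm_of_le_leastEigenvalue (hL.a_posSemidef P h5) h1 y, ?_, ?_, ?_⟩
  · exact (Finset.sum_le_sum fun i _ => (le_abs_self _).trans (h2 i)).trans (le_max_left _ _)
  · exact h3.trans ((le_max_left _ _).trans (le_max_right _ _))
  · exact h4.trans ((le_max_left _ _).trans ((le_max_right _ _).trans (le_max_right _ _)))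

/-! ### The slanted-tube barrier and its derivatives -/

/-- The squared distance defect `ε² - |x - x₀ - (t - t₀) V|²` to a moving centre. -/
noncomputable def tubeFun (z : SpaceTime d) (V : Space d) (ε : ℝ) (P : SpaceTime d) : ℝ :=
  ε ^ 2 - ‖P.2 - (z.2 + (P.1 - z.1) • V)‖ ^ 2

/-- The barrier supported in a slanted tube. -/
noncomputable def tubeBarrier (z : SpaceTime d) (V : Space d) (ε M δ : ℝ) (P : SpaceTime d) : ℝ :=
  δ * Real.exp (M * P.1) * tubeFun z V ε P ^ 2

theorem continuous_tubeFun (z : SpaceTime d) (V : Space d) (ε : ℝ) :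
    Continuous (tubeFun z V ε) := by
  unfold tubeFun
  fun_prop

theorem continuous_tubeBarrier (z : SpaceTime d) (V : Space d) (ε M δ : ℝ) :
    Continuous (tubeBarrier z V ε M δ) := by
  have := continuous_tubeFun z V ε
  unfold tubeBarrier
  fun_prop

theorem hasGradientAt_norm_sq_sub (p : Space d) (y : Space d) :
    HasGradientAt (fun y => ‖y - p‖ ^ 2) ((2 : ℝ) • (y - p)) y := by
  rw [hasGradientAt_iff_hasFDerivAt]
  have h := ((hasFDerivAt_id y).sub_const p).norm_sq
  convert! h using 1
  ext v
  simp

theorem hasDerivAt_tubeFun (z : SpaceTime d) (V : Space d) (ε : ℝ) (P : SpaceTime d) :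
    HasDerivAt (fun s => tubeFun z V ε (s, P.2))
      (2 * inner ℝ (P.2 - (z.2 + (P.1 - z.1) • V)) V) P.1 := by
  have h1 : HasDerivAt (fun s : ℝ => P.2 - (z.2 + (s - z.1) • V)) (-V) P.1 := by
    simpa using ((((hasDerivAt_id P.1).sub_const z.1).smul_const V).const_add z.2).const_sub P.2
  have h2 := (h1.norm_sq).const_sub (ε ^ 2)
  convert! h2 using 1
  simp [inner_neg_right]

theorem hasDerivAt_tubeBarrier (z : SpaceTime d) (V : Space d) (ε M δ : ℝ) (P : SpaceTime d) :
    HasDerivAt (fun s => tubeBarrier z V ε M δ (s, P.2))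
      (δ * Real.exp (M * P.1) * (M * tubeFun z V ε P ^ 2 +
        4 * tubeFun z V ε P * inner ℝ (P.2 - (z.2 + (P.1 - z.1) • V)) V)) P.1 := by
  have h1 : HasDerivAt (fun s : ℝ => δ * Real.exp (M * s)) (δ * (Real.exp (M * P.1) * M)) P.1 := by
    simpa using (((hasDerivAt_id P.1).const_mul M).exp).const_mul δ
  have h2 := h1.mul ((hasDerivAt_tubeFun z V ε P).pow 2)
  convert! h2 using 1
  simp
  ring

/-- The spatial gradient of the barrier. -/
noncomputable def tubeGrad (z : SpaceTime d) (V : Space d) (ε M δ t : ℝ) (y : Space d) :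
    Space d :=
  (-(4 * (δ * Real.exp (M * t))) * tubeFun z V ε (t, y)) • (y - (z.2 + (t - z.1) • V))

theorem hasGradientAt_tubeFun (z : SpaceTime d) (V : Space d) (ε t : ℝ) (y : Space d) :
    HasGradientAt (fun y => tubeFun z V ε (t, y)) (-((2 : ℝ) • (y - (z.2 + (t - z.1) • V)))) y := by
  rw [hasGradientAt_iff_hasFDerivAt]
  have h := (hasGradientAt_norm_sq_sub (z.2 + (t - z.1) • V) y).hasFDerivAt.const_sub (ε ^ 2)
  convert! h using 1
  exact map_neg _ _

theorem hasGradientAt_tubeBarrier (z : SpaceTime d) (V : Space d) (ε M δ t : ℝ) (y : Space d) :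
    HasGradientAt (fun y => tubeBarrier z V ε M δ (t, y)) (tubeGrad z V ε M δ t y) y := by
  rw [hasGradientAt_iff_hasFDerivAt]
  have h := ((hasGradientAt_tubeFun z V ε t y).hasFDerivAt.pow 2).const_mul
    (δ * Real.exp (M * t))
  convert! h using 1
  ext v
  simp [tubeGrad]
  ring

theorem hasFDerivAt_tubeGrad (z : SpaceTime d) (V : Space d) (ε M δ t : ℝ) (y : Space d) :
    ∃ H : Space d →L[ℝ] Space d, HasFDerivAt (tubeGrad z V ε M δ t) H y ∧
      ∀ ξ, H ξ = (δ * Real.exp (M * t)) • ((-4 * tubeFun z V ε (t, y)) • ξ +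
        (8 * inner ℝ (y - (z.2 + (t - z.1) • V)) ξ) • (y - (z.2 + (t - z.1) • V))) := by
  have h1 := (hasGradientAt_tubeFun z V ε t y).hasFDerivAt.const_mul (-(4 * (δ * Real.exp (M * t))))
  have h2 := (hasFDerivAt_id (𝕜 := ℝ) y).sub_const (z.2 + (t - z.1) • V)
  refine ⟨_, h1.smul h2, fun ξ => ?_⟩
  simp [inner_sub_left, inner_add_left, inner_smul_left]
  module

/-- The quadratic form inequality behind the interior barrier. -/
theorem tube_inequality {w M C l ε v Y tr q bY yV : ℝ} (hl : 0 < l) (hε : 0 < ε) (hC : 0 ≤ C)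
    (hv : 0 ≤ v) (hw : 0 < w) (hY0 : 0 ≤ Y) (hYw : Y ^ 2 = ε ^ 2 - w)
    (hM : M = C + (4 * ε * v + 4 * C + 4 * C * ε + 8 * l) ^ 2 / (8 * l * ε ^ 2))
    (htr : tr ≤ C) (hq : l * Y ^ 2 ≤ q) (hb : |bY| ≤ C * Y) (hV : |yV| ≤ Y * v) :
    0 < M * w ^ 2 + 4 * w * yV - 4 * w * tr + 8 * q - 4 * w * bY - C * w ^ 2 := by
  have hYε : Y ≤ ε := by
    by_contra! h
    nlinarith
  set k := 4 * ε * v + 4 * C + 4 * C * ε + 8 * l with hk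
  have hL : 0 < 8 * l * ε ^ 2 := by positivity
  have h1 : -(ε * v) ≤ yV := by
    have := neg_abs_le yV
    nlinarith [mul_le_mul_of_nonneg_right hYε hv]
  have h2 : bY ≤ C * ε := by
    have := le_abs_self bY
    nlinarith [mul_le_mul_of_nonneg_left hYε hC]
  -- With `Λ = 8lε²` this is `(kw)²/Λ - kw + Λ`, a quadratic form with negative discriminant. The
  -- constant `k` collects all terms linear in `w`, including `8l` from `8q ≥ 8l(ε² - w)`; `M` is
  -- chosen to supply the square.
  have h3 : 0 < k ^ 2 / (8 * l * ε ^ 2) * w ^ 2 - k * w + 8 * l * ε ^ 2 := by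
    have : k ^ 2 / (8 * l * ε ^ 2) * w ^ 2 - k * w + 8 * l * ε ^ 2 =
        (k ^ 2 * w ^ 2 - k * w * (8 * l * ε ^ 2) + (8 * l * ε ^ 2) ^ 2) / (8 * l * ε ^ 2) := by
      field_simp
    rw [this]
    apply div_pos _ hL
    nlinarith [sq_nonneg (k * w - 8 * l * ε ^ 2 / 2), sq_nonneg (8 * l * ε ^ 2)]
  have h4 : M * w ^ 2 = C * w ^ 2 + k ^ 2 / (8 * l * ε ^ 2) * w ^ 2 := by rw [hM]; ring
  have h5 : -(4 * w * (ε * v)) ≤ 4 * w * yV := by nlinarith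
  have h6 : 4 * w * tr ≤ 4 * w * C := by nlinarith
  have h7 : 4 * w * bY ≤ 4 * w * (C * ε) := by nlinarith
  rw [hYw] at hq
  have h8 : k * w = 4 * w * (ε * v) + 4 * w * C + 4 * w * (C * ε) + 8 * l * w := by rw [hk]; ring
  nlinarith

/-- The barrier `G = δ e^{Mt} w²` is compared with `u` on a tube from `z` to `y`. Near the lateral
side, where `w` is small, the gradient term `8q` of `tr(a D²G)` dominates by ellipticity; elsewhere
the large `M` does. -/
theorem eq_zero_of_interior_zero {Q : Set (SpaceTime d)} (hQ : IsOpen Q)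
    {a : SpaceTime d → Matrix (Fin d) (Fin d) ℝ} {b : SpaceTime d → Space d}
    {c : SpaceTime d → ℝ} (ha : ∀ P ∈ Q, (a P).PosSemidef)
    {u : SpaceTime d → ℝ} (hu : IsParabolicC2 Q u)
    (hLu : ∀ P ∈ Q, parabolicOp a b c u P ≤ 0) {z : SpaceTime d} {r l C : ℝ} (hl : 0 < l)
    (hC : 0 ≤ C) (hbd : ∀ P ∈ Metric.closedBall z r, P ∈ Q ∧
      (∀ y : Space d, l * ‖y‖ ^ 2 ≤ ∑ i, ∑ j, a P i j * (y i * y j)) ∧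
      ∑ i, a P i i ≤ C ∧ ‖b P‖ ≤ C ∧ |c P| ≤ C)
    (hneg : ∀ P ∈ Metric.closedBall z r, z.1 ≤ P.1 → u P ≤ 0) (huz : u z = 0)
    {y : SpaceTime d} (hy : y ∈ Metric.ball z (r / 2)) (hzy : z.1 < y.1) : u y = 0 := by
  have hyd : dist y z < r / 2 := hy
  have hr : 0 < r := by linarith [dist_nonneg (x := y) (y := z)]
  have hyr : y ∈ Metric.closedBall z r := Metric.mem_closedBall.2 (by linarith)
  by_contra hne
  have huy : u y < 0 := lt_of_le_of_ne (hneg y hyr hzy.le) hne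
  have hT : 0 < y.1 - z.1 := by linarith
  -- The velocity for which the axis of the tube runs from `z` to `y`.
  set V : Space d := (y.1 - z.1)⁻¹ • (y.2 - z.2) with hV
  have hVT : (y.1 - z.1) • V = y.2 - z.2 := by rw [hV, smul_inv_smul₀ hT.ne']
  -- radius of the tube
  obtain ⟨ε, hε, hεr, hεu⟩ : ∃ ε > 0, ε ≤ r / 2 ∧ ∀ x : Space d, ‖x - y.2‖ ≤ ε →
      u (y.1, x) < u y / 2 := by
    have hcy : ContinuousAt u y := hu.continuousOn.continuousAt (hQ.mem_nhds (hbd y hyr).1)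
    have h1 : ContinuousAt (fun x : Space d => u (y.1, x)) y.2 :=
      ContinuousAt.comp (f := fun x : Space d => ((y.1, x) : SpaceTime d)) hcy (by fun_prop)
    have h2 : ∀ᶠ x in 𝓝 y.2, u (y.1, x) < u y / 2 :=
      h1.eventually (gt_mem_nhds (by simpa using (by linarith : u y < u y / 2)))
    obtain ⟨ε, hε, h⟩ := Metric.nhds_basis_closedBall.eventually_iff.1 h2
    refine ⟨min ε (r / 2), by positivity, min_le_right _ _, fun x hx => h ?_⟩
    rw [Metric.mem_closedBall, dist_eq_norm]
    exact hx.trans (min_le_left _ _)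
  set M := C + (4 * ε * ‖V‖ + 4 * C + 4 * C * ε + 8 * l) ^ 2 / (8 * l * ε ^ 2) with hM
  -- On the top slice `w ≤ ε²`, so `G ≤ -u(y)/2` there, while `u < u(y)/2`: thus `u + G < 0`.
  obtain ⟨δ, hδ, hδu⟩ : ∃ δ > 0, δ * Real.exp (M * y.1) * (ε ^ 2) ^ 2 = -(u y / 2) :=
    ⟨-(u y / 2) / (Real.exp (M * y.1) * (ε ^ 2) ^ 2),
      div_pos (by linarith) (by positivity), by field_simp⟩
  set w := tubeFun z V ε with hw
  set G := tubeBarrier z V ε M δ with hG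
  set K : Set (SpaceTime d) := {P | z.1 ≤ P.1 ∧ P.1 ≤ y.1 ∧ 0 ≤ w P} with hK
  have hwc : Continuous w := continuous_tubeFun z V ε
  have hGc : Continuous G := continuous_tubeBarrier z V ε M δ
  have hnorm : ∀ P, 0 ≤ w P → ‖P.2 - (z.2 + (P.1 - z.1) • V)‖ ≤ ε := fun P hP =>
    abs_le_of_sq_le_sq' (by simpa [hw, tubeFun] using hP) hε.le |>.2
  have hKball : K ⊆ Metric.closedBall z r := by
    rintro P ⟨h1, h2, h3⟩
    have hy1 : |y.1 - z.1| < r / 2 := (le_max_left _ _).trans_lt hyd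
    have hy2 : ‖y.2 - z.2‖ < r / 2 := by
      rw [← dist_eq_norm]; exact (le_max_right _ _).trans_lt hyd
    rw [abs_of_pos hT] at hy1
    refine Metric.mem_closedBall.2 (max_le ?_ ?_)
    · rw [Real.dist_eq, abs_of_nonneg (by linarith)]; linarith
    · rw [dist_eq_norm]
      have e : P.2 - z.2 = (P.2 - (z.2 + (P.1 - z.1) • V)) + (P.1 - z.1) • V := by abel
      have h4 : ‖(P.1 - z.1) • V‖ ≤ ‖y.2 - z.2‖ := by
        rw [← hVT, norm_smul (P.1 - z.1) V, norm_smul (y.1 - z.1) V]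
        refine mul_le_mul_of_nonneg_right ?_ (norm_nonneg V)
        rw [Real.norm_of_nonneg (by linarith), Real.norm_of_nonneg hT.le]
        linarith
      rw [e]
      refine (norm_add_le _ _).trans ?_
      linarith [hnorm P h3]
  have hKclosed : IsClosed K :=
    (isClosed_le continuous_const continuous_fst).inter
      ((isClosed_le continuous_fst continuous_const).inter (isClosed_le continuous_const hwc))
  have hKc : IsCompact K := (isCompact_closedBall z r).of_isClosed_subset hKclosed hKball
  have hKQ : K ⊆ Q := fun P hP => (hbd P (hKball hP)).1
  have hwz : w z = ε ^ 2 := by simp [hw, tubeFun]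
  have hzK : z ∈ K := ⟨le_rfl, hzy.le, by rw [hwz]; positivity⟩
  obtain ⟨P, hPK, hPmax⟩ := hKc.exists_isMaxOn ⟨z, hzK⟩
    ((hu.continuousOn.mono hKQ).add hGc.continuousOn)
  have hPQ := hKQ hPK
  have hGval : ∀ R, G R = δ * Real.exp (M * R.1) * w R ^ 2 := fun R => rfl
  have hval : 0 < u P + G P := by
    have h1 := hPmax hzK
    change u z + G z ≤ u P + G P at h1
    refine lt_of_lt_of_le ?_ h1
    rw [huz, zero_add, hGval, hwz]
    positivity
  obtain ⟨hlP, htrP, hbP, hcP⟩ := (hbd P (hKball hPK)).2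
  have huP : u P ≤ 0 := hneg P (hKball hPK) hPK.1
  have hwP : 0 < w P := by
    refine lt_of_le_of_ne hPK.2.2 fun h => ?_
    rw [hGval, ← h] at hval
    simp at hval
    linarith
  have hPy : P.1 < y.1 := by
    refine lt_of_le_of_ne hPK.2.1 fun h => ?_
    have h1 := hnorm P hPK.2.2
    rw [h, hVT, add_sub_cancel] at h1
    have h2 := hεu P.2 h1
    rw [← h] at h2
    have h3 : w P ≤ ε ^ 2 := by
      simp only [hw, tubeFun]
      linarith [sq_nonneg ‖P.2 - (z.2 + (P.1 - z.1) • V)‖]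
    have h4 : G P ≤ -(u y / 2) := by
      rw [hGval, ← hδu, h]
      have := hPK.2.2
      gcongr
    have h5 : u P < u y / 2 := h2
    linarith
  obtain ⟨H, hH, hHv⟩ := hasFDerivAt_tubeGrad z V ε M δ P.1 P.2
  -- The side and the top are excluded, but `P` may lie on the bottom slice; a neighbourhood
  -- restricted to later times still lies in `K`.
  obtain ⟨h1, h2, h3⟩ := derivatives_le_of_max hQ hu hPQ (ha P hPQ)
    (hasDerivAt_tubeBarrier z V ε M δ P) (hasGradientAt_tubeBarrier z V ε M δ P.1) hH (by
      filter_upwards [continuous_fst.continuousAt.eventually (gt_mem_nhds hPy),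
        hwc.continuousAt.eventually (lt_mem_nhds hwP)] with R hR1 hR2 hR3
      exact hPmax (show R ∈ K from ⟨hPK.1.trans hR3, hR1.le, hR2.le⟩))
  set Y := P.2 - (z.2 + (P.1 - z.1) • V) with hYdef
  have hPP : tubeFun z V ε (P.1, P.2) = w P := rfl
  have hsum : ∑ i, ∑ j, a P i j * (H (EuclideanSpace.single i 1)) j =
      δ * Real.exp (M * P.1) * (-4 * w P * ∑ i, a P i i +
        8 * ∑ i, ∑ j, a P i j * (Y i * Y j)) := by
    have hin : ∀ i, inner ℝ Y (EuclideanSpace.single i (1 : ℝ)) = Y i := fun i => by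
      simp [EuclideanSpace.inner_single_right]
    simp only [hHv, hPP, hin, PiLp.smul_apply, PiLp.add_apply, smul_eq_mul,
      PiLp.single_apply]
    simp only [mul_add, Finset.sum_add_distrib, Finset.mul_sum]
    congr 1
    · refine Finset.sum_congr rfl fun i _ => ?_
      simp only [mul_ite, mul_one, mul_zero, Finset.sum_ite_eq', Finset.mem_univ, if_true]
      ring
    · refine Finset.sum_congr rfl fun i _ => Finset.sum_congr rfl fun j _ => by ring
  have hop := hLu P hPQ
  have hLdef : parabolicOp a b c u P = -timeDeriv u P - traceTerm a u P -
    inner ℝ (b P) (spaceGrad u P) + c P * u P := rfl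
  rw [hLdef, h2] at hop
  rw [hsum] at h3
  have hgr : tubeGrad z V ε M δ P.1 P.2 = (-(4 * (δ * Real.exp (M * P.1))) * w P) • Y := rfl
  rw [hgr, inner_neg_right, inner_smul_right] at hop
  have hE : 0 < δ * Real.exp (M * P.1) := by positivity
  -- Since `u ≤ 0 < u + G` at `P`, `|u| ≤ G`; this bounds `c u` from below whatever the sign of `c`.
  have hcu : -(δ * Real.exp (M * P.1) * (C * w P ^ 2)) ≤ c P * u P := by
    have h4 : |u P| ≤ δ * Real.exp (M * P.1) * w P ^ 2 := by
      rw [abs_of_nonpos huP, ← hGval]; linarith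
    have h5 : |c P * u P| ≤ C * (δ * Real.exp (M * P.1) * w P ^ 2) := by
      rw [abs_mul]
      exact mul_le_mul hcP h4 (abs_nonneg _) hC
    have h6 := neg_abs_le (c P * u P)
    linarith
  have hkey := tube_inequality (w := w P) (Y := ‖Y‖) (tr := ∑ i, a P i i)
    (q := ∑ i, ∑ j, a P i j * (Y i * Y j)) (bY := inner ℝ (b P) Y) (yV := inner ℝ Y V)
    hl hε hC (norm_nonneg V) hwP (norm_nonneg Y) (by simp [hw, tubeFun, hYdef]) hM htrP (hlP Y)
    ((abs_real_inner_le_norm _ _).trans (mul_le_mul_of_nonneg_right hbP (norm_nonneg _)))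
    (abs_real_inner_le_norm _ _)
  have := mul_pos hE hkey
  linarith

/-- The barrier needs strictly later points, as the tube velocity divides by the time difference;
points at the same time follow by continuity. -/
theorem Hypotheses.eventually_eq_zero_of_interior_zero {Q : Set (SpaceTime d)} {α : ℝ≥0}
    {a : SpaceTime d → Matrix (Fin d) (Fin d) ℝ} {b : SpaceTime d → Space d}
    {c : SpaceTime d → ℝ} (hL : Hypotheses Q α a b c)
    {u : SpaceTime d → ℝ} (hu : IsParabolicC2 Q u)
    (hLu : ∀ P ∈ Q, parabolicOp a b c u P ≤ 0) {z : SpaceTime d} (hz : z ∈ Q)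
    (hneg : ∀ᶠ P in 𝓝 z, z.1 ≤ P.1 → u P ≤ 0) (huz : u z = 0) :
    ∀ᶠ P in 𝓝 z, z.1 ≤ P.1 → u P = 0 := by
  obtain ⟨l, C, hl, hC, hbd⟩ := hL.exists_interior_bounds hz
  obtain ⟨r, hr, hball⟩ := Metric.nhds_basis_closedBall.eventually_iff.1 (hbd.and hneg)
  have hpos : ∀ P ∈ Metric.ball z (r / 2), z.1 < P.1 → u P = 0 := fun P hP ht =>
    eq_zero_of_interior_zero hL.isOpen hL.a_posSemidef hu hLu hl hC
      (fun R hR => (hball hR).1) (fun R hR => (hball hR).2) huz hP ht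
  filter_upwards [Metric.ball_mem_nhds z (half_pos hr)] with P hP ht
  rcases ht.lt_or_eq with ht | ht
  · exact hpos P hP ht
  have hPQ : P ∈ Q :=
    (hball (Metric.ball_subset_closedBall (Metric.ball_subset_ball (by linarith) hP))).1.1
  have hshift : Tendsto (fun s : ℝ => ((P.1 + s, P.2) : SpaceTime d)) (𝓝[>] 0) (𝓝 P) := by
    have : Continuous fun s : ℝ => ((P.1 + s, P.2) : SpaceTime d) := by fun_prop
    have h := this.tendsto 0
    simp only [add_zero] at h
    exact h.mono_left nhdsWithin_le_nhds
  have h1 := (hu.continuousOn.continuousAt (hL.isOpen.mem_nhds hPQ)).tendsto.comp hshift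
  refine tendsto_nhds_unique h1 (tendsto_const_nhds.congr' ?_)
  filter_upwards [hshift.eventually (Metric.isOpen_ball.mem_nhds hP), self_mem_nhdsWithin]
    with s hs hs0
  have hs0' : (0 : ℝ) < s := hs0
  exact (hpos _ hs (by simp only; linarith)).symm

/-! ### Geometry near the degenerate boundary -/

theorem eventually_mem_degBoundary {Q : Set (SpaceTime d)}
    {a : SpaceTime d → Matrix (Fin d) (Fin d) ℝ} {z : SpaceTime d} (hz : z ∈ degBoundary Q a) :
    ∀ᶠ P in 𝓝 z, P ∈ frontier Q → P ∈ degBoundary Q a := by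
  have h1 := eventually_nhdsWithin_iff.1 (eventually_eventually_nhdsWithin.2 hz.1.2)
  have h2 := eventually_nhdsWithin_iff.1 (eventually_eventually_nhdsWithin.2 hz.2.2)
  filter_upwards [h1, h2] with P hP1 hP2 hP
  exact ⟨⟨hP, hP1 hP⟩, ⟨hP, hP2 hP⟩⟩

theorem underlineSet_subset_closure {Q : Set (SpaceTime d)}
    {a : SpaceTime d → Matrix (Fin d) (Fin d) ℝ} : underlineSet Q a ⊆ closure Q :=
  union_subset subset_closure fun _ hP => frontier_subset_closure hP.1.1

theorem eventually_mem_underlineSet {Q : Set (SpaceTime d)} (hQ : IsOpen Q)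
    {a : SpaceTime d → Matrix (Fin d) (Fin d) ℝ} {z : SpaceTime d} (hz : z ∈ degBoundary Q a) :
    ∀ᶠ P in 𝓝 z, P ∈ closure Q → P ∈ underlineSet Q a := by
  filter_upwards [eventually_mem_degBoundary hz] with P hP hPQ
  by_cases h : P ∈ Q
  · exact Or.inl h
  · exact Or.inr (hP (by rw [hQ.frontier_eq]; exact ⟨hPQ, h⟩))

theorem tendsto_add_smul (P v : SpaceTime d) :
    Tendsto (fun s : ℝ => P + s • v) (𝓝 0) (𝓝 P) := by
  have h : Continuous fun s : ℝ => P + s • v := by fun_prop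
  simpa using h.tendsto 0

theorem tendsto_add_smul_nhdsGT (P v : SpaceTime d) :
    Tendsto (fun s : ℝ => P + s • v) (𝓝[>] 0) (𝓝 P) :=
  (tendsto_add_smul P v).mono_left nhdsWithin_le_nhds

/-- A direction with positive normal component enters `Q`, where `ρ > 0`, so `l` is non-negative on
that half-space. A non-zero functional with this property is a positive multiple of the normal. -/
theorem exists_fderiv_eq_inner {Q : Set (SpaceTime d)} {z ν : SpaceTime d}
    (hν : IsInwardNormal Q z ν) (hν0 : ν.1 = 0) {U : Set (SpaceTime d)} {ρ : SpaceTime d → ℝ}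
    (hU : U ∈ 𝓝 z) {l : SpaceTime d →L[ℝ] ℝ} (hl : HasFDerivAt ρ l z) (hl0 : l ≠ 0)
    (hpos : Q ∩ U = {P ∈ U | 0 < ρ P}) (hz : ρ z = 0) :
    ∃ k : ℝ, 0 < k ∧ ∀ v, l v = k * inner ℝ ν.2 v.2 := by
  have hnn : ∀ v : SpaceTime d, 0 < inner ℝ ν.2 v.2 → 0 ≤ l v := by
    intro v hv
    by_contra! hneg
    have hv0 : 0 < ‖v‖ := by
      rw [norm_pos_iff]
      rintro rfl
      simp at hv
    -- The tolerance is chosen so that `ε ‖s v‖` is half of `s ⟨ν, v⟩`.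
    have hQ : ∀ᶠ s in 𝓝[>] (0 : ℝ), z + s • v ∈ Q := by
      have h := (tendsto_add_smul_nhdsGT z v).eventually
        (hν.2 (inner ℝ ν.2 v.2 / (2 * ‖v‖)) (by positivity))
      filter_upwards [h, self_mem_nhdsWithin] with s hs hs0
      have hs0' : 0 < s := hs0
      refine hs.1 ?_
      have e : inner ℝ (s • v.2) ν.2 = s * inner ℝ ν.2 v.2 := by
        rw [inner_smul_left, real_inner_comm]; rfl
      simp only [add_sub_cancel_left, hν0, mul_zero, zero_add, Prod.snd_add, Prod.smul_snd, e,
        norm_smul, Real.norm_of_nonneg hs0'.le]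
      have e2 : inner ℝ ν.2 v.2 / (2 * ‖v‖) * (s * ‖v‖) = s * inner ℝ ν.2 v.2 / 2 := by
        field_simp
      rw [e2]
      have := mul_pos hs0' hv
      linarith
    have hline : HasDerivAt (fun s : ℝ => ρ (z + s • v)) (l v) 0 := by
      have h0 : HasFDerivAt ρ l (z + (0 : ℝ) • v) := by simpa using hl
      refine h0.comp_hasDerivAt (0 : ℝ) ?_
      simpa using ((hasDerivAt_id (0 : ℝ)).smul_const v).const_add z
    have h2 : ∀ᶠ s in 𝓝[>] (0 : ℝ), slope (fun s : ℝ => ρ (z + s • v)) 0 s < 0 :=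
      ((hasDerivAt_iff_tendsto_slope.1 hline).eventually (gt_mem_nhds hneg)).filter_mono
        (nhdsWithin_mono _ fun s hs => ne_of_gt hs)
    obtain ⟨s, hs1, hs2, hs3, hs4⟩ := (hQ.and (h2.and
      (((tendsto_add_smul_nhdsGT z v).eventually hU).and
        self_mem_nhdsWithin))).exists
    have hs5 : z + s • v ∈ {P ∈ U | 0 < ρ P} := hpos ▸ ⟨hs1, hs3⟩
    have hs4' : 0 < s := hs4
    have := hs5.2
    rw [slope_def_field] at hs2
    simp only [zero_smul, add_zero, hz, sub_zero] at hs2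
    exact absurd (div_pos this hs4') hs2.not_gt
  have hν2 : ‖ν.2‖ ^ 2 = 1 := by simpa [hν0] using hν.1
  have hνν : inner ℝ ν.2 ν.2 = 1 := by rw [real_inner_self_eq_norm_sq, hν2]
  have hnn' : ∀ v : SpaceTime d, 0 ≤ inner ℝ ν.2 v.2 → 0 ≤ l v := by
    intro v hv
    have h : ∀ ε > 0, 0 ≤ l v + ε * l ν := fun ε hε => by
      have := hnn (v + ε • ν) (by
        simp only [Prod.snd_add, Prod.smul_snd, inner_add_right, inner_smul_right, hνν]
        linarith)
      simpa using this
    have ht : Tendsto (fun ε : ℝ => l v + ε * l ν) (𝓝[>] 0) (𝓝 (l v)) := by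
      have : Continuous fun ε : ℝ => l v + ε * l ν := by fun_prop
      have h := this.tendsto 0
      simp only [zero_mul, add_zero] at h
      exact h.mono_left nhdsWithin_le_nhds
    exact ge_of_tendsto ht (eventually_nhdsWithin_of_forall h)
  have hz' : ∀ v : SpaceTime d, inner ℝ ν.2 v.2 = 0 → l v = 0 := by
    intro v hv
    refine le_antisymm ?_ (hnn' v hv.ge)
    have := hnn' (-v) (by simp [hv])
    simpa using this
  have hform : ∀ v, l v = l ν * inner ℝ ν.2 v.2 := by
    intro v
    have := hz' (v - (inner ℝ ν.2 v.2 : ℝ) • ν) (by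
      simp only [Prod.snd_sub, Prod.smul_snd, inner_sub_right, inner_smul_right, hνν]
      ring)
    rw [map_sub, map_smul, smul_eq_mul] at this
    linarith
  refine ⟨l ν, lt_of_le_of_ne (hnn' ν (by rw [hνν]; exact zero_le_one)) fun h => hl0 ?_, hform⟩
  refine ContinuousLinearMap.ext fun v => ?_
  rw [hform v, ← h, zero_mul]
  rfl

/-- Near a point of the degenerate boundary, directions pointing to the inner side lead into `Q`,
and the boundary is close to its tangent plane. -/
theorem Hypotheses.exists_normal {Q : Set (SpaceTime d)} {α : ℝ≥0}
    {a : SpaceTime d → Matrix (Fin d) (Fin d) ℝ} {b : SpaceTime d → Space d}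
    {c : SpaceTime d → ℝ} (hL : Hypotheses Q α a b c) {z : SpaceTime d}
    (hz : z ∈ degBoundary Q a) :
    ∃ n : Space d, 0 < inner ℝ (b z) n ∧
      (∀ v : SpaceTime d, 0 < inner ℝ n v.2 → ∃ s₀ : ℝ, 0 < s₀ ∧ ∀ᶠ P in 𝓝 z, P ∈ closure Q →
        ∀ s, 0 < s → s ≤ s₀ → P + s • v ∈ Q) ∧
      ∀ κ : ℝ, 0 < κ → ∀ᶠ P in 𝓝 z, P ∈ frontier Q → |inner ℝ n (P.2 - z.2)| ≤ κ * ‖P - z‖ := by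
  obtain ⟨U, ρ, -, hU, hzU, hρ, -, hρ0, hpos, hzero⟩ := hL.boundary_c1alpha z hz
  obtain ⟨ν, hν, hν0⟩ := hz.2.2.self_of_nhdsWithin hz.2.1
  have hUz : U ∈ 𝓝 z := hU.mem_nhds hzU
  have hfd : ∀ P ∈ U, HasFDerivAt ρ (fderiv ℝ ρ P) P := fun P hP =>
    ((hρ.differentiableOn one_ne_zero).differentiableAt (hU.mem_nhds hP)).hasFDerivAt
  have hfr : ∀ P ∈ frontier Q, P ∈ U → ρ P = 0 := fun P hP hPU =>
    (show P ∈ {P ∈ U | ρ P = 0} from hzero ▸ ⟨hP, hPU⟩).2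
  have hρz : ρ z = 0 := hfr z hz.1.1 hzU
  obtain ⟨k, hk, hform⟩ := exists_fderiv_eq_inner hν hν0 hUz (hfd z hzU) (hρ0 z hzU) hpos hρz
  -- With this scaling `n` represents the differential of `ρ` at `z` itself.
  refine ⟨k • ν.2, ?_, ?_, ?_⟩
  · rw [inner_smul_right]
    exact mul_pos hk (hL.b_normal_pos z hz ν hν)
  · intro v hv
    rw [inner_smul_left] at hv
    have hzv : 0 < fderiv ℝ ρ z v := by rw [hform]; exact hv
    have hcont : ContinuousAt (fun P => fderiv ℝ ρ P v) z :=
      ((hρ.continuousOn_fderiv_of_isOpen hU le_rfl).continuousAt hUz).clm_apply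
        continuousAt_const
    obtain ⟨R, hR, hball⟩ := Metric.nhds_basis_ball.eventually_iff.1
      ((hcont.eventually (lt_mem_nhds hzv)).and hUz)
    refine ⟨R / (2 * (‖v‖ + 1)), by positivity, ?_⟩
    filter_upwards [Metric.ball_mem_nhds z (half_pos hR)] with P hP hPQ s hs hss
    have hin : ∀ x ∈ Icc 0 s, P + x • v ∈ Metric.ball z R := by
      intro x hx
      rw [Metric.mem_ball, dist_eq_norm] at hP ⊢
      have e : P + x • v - z = (P - z) + x • v := by abel
      rw [e]
      refine (norm_add_le _ _).trans_lt ?_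
      rw [norm_smul, Real.norm_of_nonneg hx.1]
      have h1 : x * ‖v‖ ≤ R / (2 * (‖v‖ + 1)) * ‖v‖ :=
        mul_le_mul_of_nonneg_right (hx.2.trans hss) (norm_nonneg v)
      have h2 : R / (2 * (‖v‖ + 1)) * ‖v‖ ≤ R / 2 := by
        rw [div_mul_eq_mul_div, div_le_div_iff₀ (by positivity) (by positivity)]
        nlinarith [norm_nonneg v]
      linarith
    have hder : ∀ x ∈ Icc 0 s, HasDerivAt (fun x : ℝ => ρ (P + x • v))
        (fderiv ℝ ρ (P + x • v) v) x := fun x hx => by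
      refine (hfd _ (hball (hin x hx)).2).comp_hasDerivAt x ?_
      simpa using ((hasDerivAt_id x).smul_const v).const_add P
    -- `ρ ≥ 0` on the closure near `z`, and the derivative of `ρ` along `v` stays positive near `z`,
    -- so `ρ > 0` after any short positive step.
    have hmono : StrictMonoOn (fun x : ℝ => ρ (P + x • v)) (Icc 0 s) := by
      refine strictMonoOn_of_deriv_pos (convex_Icc 0 s)
        (fun x hx => (hder x hx).continuousAt.continuousWithinAt) fun x hx => ?_
      have hx' := interior_subset hx
      rw [(hder x hx').deriv]
      exact (hball (hin x hx')).1
    have h0 : 0 ≤ ρ P := by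
      have hPU : P ∈ U := by
        have := (hball (hin 0 (left_mem_Icc.2 hs.le))).2
        rwa [zero_smul, add_zero] at this
      by_cases hPQ' : P ∈ Q
      · exact (show P ∈ {P ∈ U | 0 < ρ P} from hpos ▸ ⟨hPQ', hPU⟩).2.le
      · exact (hfr P (by rw [hL.isOpen.frontier_eq]; exact ⟨hPQ, hPQ'⟩) hPU).ge
    have h1 := hmono (left_mem_Icc.2 hs.le) (right_mem_Icc.2 hs.le) hs
    simp only [zero_smul, add_zero] at h1
    have h2 : P + s • v ∈ {P ∈ U | 0 < ρ P} :=
      ⟨(hball (hin s (right_mem_Icc.2 hs.le))).2, by linarith⟩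
    rw [← hpos] at h2
    exact h2.1
  · intro κ hκ
    filter_upwards [(hfd z hzU).isLittleO.bound hκ, hUz] with P hP hPU hPf
    rw [hfr P hPf hPU, hρz, sub_zero, zero_sub, norm_neg, hform, Real.norm_eq_abs] at hP
    rw [inner_smul_left]
    exact hP

/-- Any two points near a point of the degenerate boundary can be joined through `Q`. -/
theorem Hypotheses.exists_nhds_reachSet {Q : Set (SpaceTime d)} {α : ℝ≥0}
    {a : SpaceTime d → Matrix (Fin d) (Fin d) ℝ} {b : SpaceTime d → Space d}
    {c : SpaceTime d → ℝ} (hL : Hypotheses Q α a b c) {z : SpaceTime d}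
    (hz : z ∈ degBoundary Q a) :
    ∃ N ∈ 𝓝 z, ∀ Y, Q ⊆ Y → Y ⊆ closure Q → ∀ P ∈ N, ∀ R ∈ N, P ∈ Y → R ∈ Y → R.1 ≤ P.1 →
      P ∈ reachSet Y R := by
  obtain ⟨n, hn, hcone, -⟩ := hL.exists_normal hz
  -- Moving along `b z` leaves time unchanged and leads into `Q`. The path goes from `P` into a ball
  -- inside `Q`, crosses it by a segment, and returns to `R`.
  set v : SpaceTime d := (0, b z) with hv
  obtain ⟨s₀, hs₀, hs⟩ := hcone v (by rw [real_inner_comm]; exact hn)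
  have hzQ : z + s₀ • v ∈ Q :=
    hs.self_of_nhds (frontier_subset_closure hz.1.1) s₀ hs₀ le_rfl
  obtain ⟨ε, hε, hball⟩ := Metric.isOpen_iff.1 hL.isOpen _ hzQ
  have hct : Tendsto (fun P : SpaceTime d => P + s₀ • v) (𝓝 z) (𝓝 (z + s₀ • v)) := by
    have : Continuous fun P : SpaceTime d => P + s₀ • v := by fun_prop
    exact this.tendsto z
  refine ⟨_, hs.and (hct.eventually (Metric.ball_mem_nhds _ hε)), ?_⟩
  rintro Y hQY hYc P ⟨hP1, hP2⟩ R ⟨hR1, hR2⟩ hPY hRY ht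
  have hseg : ∀ S ∈ Y, (S ∈ closure Q → ∀ s, 0 < s → s ≤ s₀ → S + s • v ∈ Q) →
      segment ℝ S (S + s₀ • v) ⊆ Y := by
    intro S hS h
    rw [segment_eq_image']
    rintro _ ⟨θ, hθ, rfl⟩
    simp only [add_sub_cancel_left, smul_smul]
    rcases hθ.1.eq_or_lt with h0 | h0
    · simpa [← h0] using hS
    · exact hQY (h (hYc hS) _ (mul_pos h0 hs₀) (by nlinarith [hθ.2]))
  have h1 : P ∈ reachSet Y (P + s₀ • v) :=
    reachSet_of_segment (hseg P hPY hP1) (by simp [hv])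
  have h2 : P + s₀ • v ∈ reachSet Y (R + s₀ • v) := by
    refine reachSet_of_segment ?_ (by simpa [hv] using ht)
    exact (((convex_ball _ ε).segment_subset hP2 hR2).trans hball).trans hQY
  have h3 : R + s₀ • v ∈ reachSet Y R := by
    refine reachSet_of_segment ?_ (by simp [hv])
    rw [segment_symm]
    exact hseg R hRY hR1
  exact reachSet_trans h1 (reachSet_trans h2 h3)

/-! ### The equation at the degenerate boundary -/

/-- The first-order inequality satisfied at the degenerate boundary in the direction `(1, b)`. -/
theorem Hypotheses.eventually_le_sub_of_degBoundary {Q : Set (SpaceTime d)} {α : ℝ≥0}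
    {a : SpaceTime d → Matrix (Fin d) (Fin d) ℝ} {b : SpaceTime d → Space d}
    {c : SpaceTime d → ℝ} (hL : Hypotheses Q α a b c)
    {u : SpaceTime d → ℝ} (hu : IsC2s Q a u)
    (hLu : ∀ P ∈ Q, parabolicOp a b c u P ≤ 0) {P : SpaceTime d} (hP : P ∈ degBoundary Q a)
    {ε : ℝ} (hε : 0 < ε) :
    ∀ᶠ s in 𝓝[>] (0 : ℝ), P + s • ((1, b P) : SpaceTime d) ∈ Q ∧
      (c P * u P - ε) * s ≤ u (P + s • ((1, b P) : SpaceTime d)) - u P := by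
  obtain ⟨n, hn, hcone, -⟩ := hL.exists_normal hP
  set v : SpaceTime d := (1, b P) with hv
  have hPX : P ∈ underlineSet Q a := Or.inr hP
  obtain ⟨s₀, hs₀, hs⟩ := hcone v (by rw [real_inner_comm]; exact hn)
  have hin : ∀ s, 0 < s → s ≤ s₀ → P + s • v ∈ Q :=
    hs.self_of_nhds (frontier_subset_closure hP.1.1)
  obtain ⟨D, hDc, hD⟩ := hu.exists_grad
  obtain ⟨g, hgc, hg, hg0⟩ := hu.exists_trace
  -- By `Lu ≤ 0`, `F` bounds the derivative of `u` along `(1, b P)` from below in `Q`. It contains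
  -- no `u_t`, hence is continuous up to `P`, where it equals `c u`.
  set F : SpaceTime d → ℝ := fun R =>
    -g R - inner ℝ (b R - b P) (D R) + c R * u R with hF
  have hFc : ContinuousWithinAt F (underlineSet Q a) P :=
    ((hgc P hPX).neg.sub (((hL.b_continuous P hP).sub continuousWithinAt_const).inner
      (hDc P hPX))).add ((hL.c_continuous P hP).mul (hu.continuousOn P hPX))
  have hFP : F P = c P * u P := by simp [hF, hg0 P hP]
  have hIoc : ∀ᶠ s in 𝓝[>] (0 : ℝ), s ∈ Ioc 0 s₀ := Ioc_mem_nhdsGT hs₀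
  have htend : Tendsto (fun s : ℝ => P + s • v) (𝓝[>] 0) (𝓝[underlineSet Q a] P) :=
    tendsto_nhdsWithin_iff.2 ⟨tendsto_add_smul_nhdsGT P v,
      hIoc.mono fun s hs => Or.inl (hin s hs.1 hs.2)⟩
  have hev : ∀ᶠ s in 𝓝[>] (0 : ℝ), c P * u P - ε < F (P + s • v) :=
    htend.eventually (hFc.eventually (lt_mem_nhds (by rw [hFP]; linarith)))
  obtain ⟨s₁, hs₁, hs₁F⟩ := mem_nhdsGT_iff_exists_Ioc_subset.1 (hIoc.and hev)
  have hs₁' : (0 : ℝ) < s₁ := hs₁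
  filter_upwards [Ioc_mem_nhdsGT hs₁'] with s hs
  refine ⟨hin s hs.1 (hs₁F hs).1.2, ?_⟩
  have hder : ∀ x ∈ Ioc 0 s, HasDerivAt (fun x : ℝ => u (P + x • v))
      (timeDeriv u (P + x • v) + inner ℝ (spaceGrad u (P + x • v)) (b P)) x := by
    intro x hx
    obtain ⟨L, hLd, hLv⟩ := hu.isParabolicC2.hasFDerivAt hL.isOpen
      (hin x hx.1 (hs₁F ⟨hx.1, hx.2.trans hs.2⟩).1.2)
    have h1 : HasDerivAt (fun x : ℝ => P + x • v) v x := by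
      simpa using ((hasDerivAt_id x).smul_const v).const_add P
    have h2 := hLd.comp_hasDerivAt x h1
    rw [hLv] at h2
    simpa [hv] using! h2
  have hmvt := Convex.mul_sub_le_image_sub_of_le_deriv (convex_Icc 0 s)
    (f := fun x : ℝ => u (P + x • v)) (C := c P * u P - ε) (by
      refine hu.continuousOn.comp (by fun_prop) fun x hx => ?_
      rcases hx.1.eq_or_lt with h | h
      · simpa [← h] using hPX
      · exact Or.inl (hin x h (hs₁F ⟨h, hx.2.trans hs.2⟩).1.2)) (by
      intro x hx
      rw [interior_Icc] at hx
      exact (hder x ⟨hx.1, hx.2.le⟩).differentiableAt.differentiableWithinAt) (by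
      intro x hx
      rw [interior_Icc] at hx
      rw [(hder x ⟨hx.1, hx.2.le⟩).deriv]
      have hx1 := hs₁F ⟨hx.1, hx.2.le.trans hs.2⟩
      have hxQ := hin x hx.1 hx1.1.2
      refine hx1.2.le.trans ?_
      have hop : -timeDeriv u (P + x • v) - traceTerm a u (P + x • v) -
        inner ℝ (b (P + x • v)) (spaceGrad u (P + x • v)) +
        c (P + x • v) * u (P + x • v) ≤ 0 := hLu _ hxQ
      simp only [hF]
      rw [hD hxQ, hg hxQ, inner_sub_left, real_inner_comm (b P)]
      linarith)
    0 (left_mem_Icc.2 hs.1.le) s (right_mem_Icc.2 hs.1.le) hs.1.le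
  simpa using hmvt

/-! ### Quadratic test functions and touching at the degenerate boundary -/

/-- A quadratic test function vanishing at `z`. -/
noncomputable def quadFun (z : SpaceTime d) (q : Space d) (τ γ : ℝ) (P : SpaceTime d) : ℝ :=
  inner ℝ q (P.2 - z.2) + τ * (P.1 - z.1) - γ * (‖P.2 - z.2‖ ^ 2 + (P.1 - z.1) ^ 2)

theorem continuous_quadFun (z : SpaceTime d) (q : Space d) (τ γ : ℝ) :
    Continuous (quadFun z q τ γ) := by
  unfold quadFun
  fun_prop

theorem hasDerivAt_quadFun (z : SpaceTime d) (q : Space d) (τ γ : ℝ) (P : SpaceTime d) :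
    HasDerivAt (fun s => quadFun z q τ γ (s, P.2)) (τ - 2 * γ * (P.1 - z.1)) P.1 := by
  have h := (hasDerivAt_id P.1).sub_const z.1
  have h2 := ((h.const_mul τ).const_add (inner ℝ q (P.2 - z.2))).sub
    (((h.pow 2).const_add (‖P.2 - z.2‖ ^ 2)).const_mul γ)
  convert! h2 using 1
  simp
  ring

theorem hasGradientAt_quadFun (z : SpaceTime d) (q : Space d) (τ γ t : ℝ) (y : Space d) :
    HasGradientAt (fun y => quadFun z q τ γ (t, y)) (q - (2 * γ) • (y - z.2)) y := by
  rw [hasGradientAt_iff_hasFDerivAt]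
  have h1 : HasFDerivAt (fun y => inner ℝ q (y - z.2)) (innerSL ℝ q) y := by
    have := (innerSL ℝ q).hasFDerivAt.comp y ((hasFDerivAt_id (𝕜 := ℝ) y).sub_const z.2)
    simpa using! this
  have h2 := (h1.add_const (τ * (t - z.1))).sub
    (((hasGradientAt_norm_sq_sub z.2 y).hasFDerivAt.add_const ((t - z.1) ^ 2)).const_mul γ)
  convert! h2 using 1
  ext v
  simp
  ring

theorem hasDerivAt_quadFun_line (z : SpaceTime d) (q : Space d) (τ γ : ℝ) (P : SpaceTime d)
    (e : Space d) :
    HasDerivAt (fun s : ℝ => quadFun z q τ γ (P + s • ((1, e) : SpaceTime d)))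
      (τ - 2 * γ * (P.1 - z.1) + inner ℝ e (q - (2 * γ) • (P.2 - z.2))) 0 := by
  have h1 : HasDerivAt (fun s : ℝ => P.2 + s • e - z.2) e 0 := by
    simpa using (((hasDerivAt_id (0 : ℝ)).smul_const e).const_add P.2).sub_const z.2
  have h2 : HasDerivAt (fun s : ℝ => P.1 + s - z.1) 1 0 := by
    simpa using ((hasDerivAt_id (0 : ℝ)).const_add P.1).sub_const z.1
  have h3 := (((hasDerivAt_const (0 : ℝ) q).inner ℝ h1).add (h2.const_mul τ)).sub
    ((h1.norm_sq.add (h2.pow 2)).const_mul γ)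
  have e1 : (fun s : ℝ => quadFun z q τ γ (P + s • ((1, e) : SpaceTime d))) = fun s : ℝ =>
      inner ℝ q (P.2 + s • e - z.2) + τ * (P.1 + s - z.1) -
        γ * (‖P.2 + s • e - z.2‖ ^ 2 + (P.1 + s - z.1) ^ 2) := by
    ext s
    simp [quadFun]
  rw [e1]
  convert! h3 using 1
  simp only [zero_smul, add_zero, inner_sub_right, inner_smul_right, inner_zero_left,
    real_inner_comm e]
  norm_num
  ring

/-- On the compact set where `g ≥ 0`, `f` has a negative maximum, so a small multiple of the bounded
`g` cannot compensate it; elsewhere both terms help. -/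
theorem exists_pos_forall_add_mul_neg {E : Type*} [TopologicalSpace E] {K : Set E}
    (hK : IsCompact K) {f g : E → ℝ} (hf : ContinuousOn f K) (hg : ContinuousOn g K)
    (hf0 : ∀ x ∈ K, f x ≤ 0) (hfg : ∀ x ∈ K, f x = 0 → g x < 0) :
    ∃ δ : ℝ, 0 < δ ∧ ∀ x ∈ K, f x + δ * g x < 0 := by
  obtain ⟨B, hB⟩ := hK.exists_bound_of_continuousOn hg
  have hK' : IsCompact (K ∩ g ⁻¹' Ici 0) := by
    obtain ⟨t, ht, hte⟩ := continuousOn_iff_isClosed.1 hg (Ici 0) isClosed_Ici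
    rw [inter_comm, hte, inter_comm]
    exact hK.inter_right ht
  rcases (K ∩ g ⁻¹' Ici 0).eq_empty_or_nonempty with he | hne
  · refine ⟨1, one_pos, fun x hx => ?_⟩
    have hgx : g x < 0 := by
      by_contra! h
      exact (he ▸ (⟨hx, h⟩ : x ∈ K ∩ g ⁻¹' Ici 0) : x ∈ (∅ : Set E))
    have := hf0 x hx
    linarith
  · obtain ⟨y, hy, hmax⟩ := hK'.exists_isMaxOn hne (hf.mono inter_subset_left)
    have hfy : f y < 0 := lt_of_le_of_ne (hf0 y hy.1) fun h => (hfg y hy.1 h).not_ge hy.2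
    have hB0 : 0 ≤ B := (norm_nonneg _).trans (hB y hy.1)
    refine ⟨-f y / (B + 1), div_pos (by linarith) (by linarith), fun x hx => ?_⟩
    have hδ : 0 < -f y / (B + 1) := div_pos (by linarith) (by linarith)
    rcases lt_or_ge (g x) 0 with h | h
    · have := hf0 x hx
      have := mul_neg_of_pos_of_neg hδ h
      linarith
    · have h1 : f x ≤ f y := hmax (show x ∈ K ∩ g ⁻¹' Ici 0 from ⟨hx, h⟩)
      have h2 : g x ≤ B := (le_abs_self _).trans (hB x hx)
      have h3 : -f y / (B + 1) * g x ≤ -f y / (B + 1) * B := mul_le_mul_of_nonneg_left h2 hδ.le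
      have h4 : -f y / (B + 1) * B < -f y := by
        rw [div_mul_eq_mul_div, div_lt_iff₀ (by linarith)]
        nlinarith
      linarith

/-- If a quadratic function touches the zero set of `u` at a point of the degenerate boundary from
outside, then its derivative in the direction `(1, b)` is not positive. -/
theorem Hypotheses.deriv_nonpos_of_touching {Q : Set (SpaceTime d)} {α : ℝ≥0}
    {a : SpaceTime d → Matrix (Fin d) (Fin d) ℝ} {b : SpaceTime d → Space d}
    {c : SpaceTime d → ℝ} (hL : Hypotheses Q α a b c)
    {u : SpaceTime d → ℝ} (hu : IsC2s Q a u)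
    (hLu : ∀ P ∈ Q, parabolicOp a b c u P ≤ 0) {z : SpaceTime d} (hz : z ∈ degBoundary Q a)
    (hneg : ∀ᶠ P in 𝓝 z, P ∈ underlineSet Q a → z.1 ≤ P.1 → u P ≤ 0) (huz : u z = 0)
    {q : Space d} {τ γ : ℝ}
    (htouch : ∀ᶠ P in 𝓝 z, P ∈ underlineSet Q a → z.1 ≤ P.1 → u P = 0 → P ≠ z →
      quadFun z q τ γ P < 0) :
    τ + inner ℝ (b z) q ≤ 0 := by
  by_contra! hpos
  set ψ := quadFun z q τ γ with hψ
  have hψc : Continuous ψ := continuous_quadFun z q τ γ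
  have hψz : ψ z = 0 := by simp [hψ, quadFun]
  have hzX : z ∈ underlineSet Q a := Or.inr hz
  set θ := (τ + inner ℝ (b z) q) / 2 with hθ
  have hθ0 : 0 < θ := by positivity
  -- first-order part
  have hfirst : ∀ᶠ P in 𝓝 z, P ∈ underlineSet Q a →
      θ < τ - 2 * γ * (P.1 - z.1) + inner ℝ (b P) (q - (2 * γ) • (P.2 - z.2)) -
        |c P| * |ψ P| := by
    have h1 : ContinuousWithinAt (fun P : SpaceTime d => τ - 2 * γ * (P.1 - z.1) +
        inner ℝ (b P) (q - (2 * γ) • (P.2 - z.2)) - |c P| * |ψ P|) (underlineSet Q a) z := by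
      refine ContinuousWithinAt.sub (ContinuousWithinAt.add ?_
        ((hL.b_continuous z hz).inner ?_)) ((hL.c_continuous z hz).abs.mul ?_)
      · exact Continuous.continuousWithinAt (by fun_prop)
      · exact Continuous.continuousWithinAt (by fun_prop)
      · exact (continuous_abs.comp hψc).continuousWithinAt
    refine eventually_nhdsWithin_iff.1 (h1.eventually (lt_mem_nhds ?_))
    simp only [sub_self, mul_zero, smul_zero, sub_zero, hψz, abs_zero]
    linarith
  -- second-order part
  have hsecond : ∀ᶠ P in 𝓝 z, P ∈ Q → 2 * γ * ∑ i, a P i i < θ := by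
    have h0 : Tendsto a (𝓝[Q] z) (𝓝 0) := hz.1.2.self_of_nhdsWithin hz.1.1
    have h1 : Tendsto (fun P => 2 * γ * ∑ i, a P i i) (𝓝[Q] z)
        (𝓝 (2 * γ * ∑ i : Fin d, (0 : Matrix (Fin d) (Fin d) ℝ) i i)) := by
      refine Tendsto.const_mul _ (tendsto_finsetSum _ fun i _ => ?_)
      exact tendsto_pi_nhds.1 (tendsto_pi_nhds.1 h0 i) i
    simp only [Matrix.zero_apply, Finset.sum_const_zero, mul_zero] at h1
    exact eventually_nhdsWithin_iff.1 (h1.eventually (gt_mem_nhds hθ0))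
  obtain ⟨r, hr, hball⟩ := Metric.nhds_basis_closedBall.eventually_iff.1
    (hfirst.and (hsecond.and (hneg.and (htouch.and (eventually_mem_underlineSet hL.isOpen hz)))))
  set K : Set (SpaceTime d) := Metric.closedBall z r ∩ (closure Q ∩ {P | z.1 ≤ P.1}) with hK
  have hKc : IsCompact K := (isCompact_closedBall z r).inter_right
    (isClosed_closure.inter (isClosed_le continuous_const continuous_fst))
  have hKX : K ⊆ underlineSet Q a := fun P hP => (hball hP.1).2.2.2.2 hP.2.1
  have hzK : z ∈ K := ⟨Metric.mem_closedBall_self hr.le, underlineSet_subset_closure hzX, le_refl z.1⟩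
  have huK : ∀ P ∈ K, u P ≤ 0 := fun P hP => (hball hP.1).2.2.1 (hKX hP) hP.2.2
  have huc : ContinuousOn u K := hu.continuousOn.mono hKX
  -- On the sphere, touching gives `ψ < 0` wherever `u = 0`. A small `δ` thus makes `u + δψ < 0`
  -- there, and its maximum over `K`, being at least its value `0` at `z`, lies in the open ball.
  obtain ⟨δ, hδ, hδK⟩ := exists_pos_forall_add_mul_neg
    (hKc.inter_right (Metric.isClosed_sphere (x := z) (ε := r)))
    (huc.mono inter_subset_left) hψc.continuousOn (fun P hP => huK P hP.1) (fun P hP h0 =>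
      (hball hP.1.1).2.2.2.1 (hKX hP.1) hP.1.2.2 h0 (by
        rintro rfl
        have := hP.2
        rw [Metric.mem_sphere, dist_self] at this
        exact hr.ne this))
  obtain ⟨P, hPK, hPmax⟩ := hKc.exists_isMaxOn ⟨z, hzK⟩
    (f := fun P => u P + δ * ψ P) (huc.add (continuous_const.mul hψc).continuousOn)
  have hval : 0 ≤ u P + δ * ψ P := by
    have h := hPmax hzK
    change u z + δ * ψ z ≤ u P + δ * ψ P at h
    rw [huz, hψz] at h
    linarith
  have hPball : P ∈ Metric.ball z r := by
    refine lt_of_le_of_ne (Metric.mem_closedBall.1 hPK.1) fun h => ?_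
    exact (hδK P ⟨hPK, h⟩).not_ge hval
  have huP := huK P hPK
  -- As in the interior, `u ≤ 0 ≤ u + δψ`; here `|ψ|` is small near `z`, so `c u` is negligible
  -- against `δθ`.
  have habs : |c P * u P| ≤ δ * (|c P| * |ψ P|) := by
    have h1 : |u P| ≤ δ * |ψ P| := by
      rw [abs_of_nonpos huP]
      have := mul_le_mul_of_nonneg_left (le_abs_self (ψ P)) hδ.le
      linarith
    rw [abs_mul]
    have := mul_le_mul_of_nonneg_left h1 (abs_nonneg (c P))
    linarith
  have hcu := neg_abs_le (c P * u P)
  have hf := mul_lt_mul_of_pos_left ((hball hPK.1).1 (hKX hPK)) hδ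
  have hmaxK : ∀ R ∈ K, u R + δ * ψ R ≤ u P + δ * ψ P := fun R hR => hPmax hR
  rcases hKX hPK with hPQ | hPD
  · have hs := mul_lt_mul_of_pos_left ((hball hPK.1).2.1 hPQ) hδ
    have hGx : ∀ y, HasGradientAt (fun y => δ * ψ (P.1, y))
        (δ • (q - (2 * γ) • (y - z.2))) y := fun y => by
      rw [hasGradientAt_iff_hasFDerivAt, map_smul]
      exact (hasGradientAt_quadFun z q τ γ P.1 y).hasFDerivAt.const_mul δ
    have hH : HasFDerivAt (fun y : Space d => δ • (q - (2 * γ) • (y - z.2)))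
        ((-(2 * δ * γ)) • ContinuousLinearMap.id ℝ (Space d)) P.2 := by
      have h1 := ((((hasFDerivAt_id (𝕜 := ℝ) P.2).sub_const z.2).const_smul (2 * γ)).const_sub
        q).const_smul δ
      convert! h1 using 1
      ext v
      simp
      ring
    obtain ⟨h1, h2, h3⟩ := derivatives_le_of_max (G := fun R => δ * ψ R) hL.isOpen
      hu.isParabolicC2 hPQ (hL.a_posSemidef P hPQ)
      ((hasDerivAt_quadFun z q τ γ P).const_mul δ) hGx hH (by
        filter_upwards [Metric.isOpen_ball.mem_nhds hPball, hL.isOpen.mem_nhds hPQ]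
          with R hR1 hR2 hR3
        exact hmaxK R ⟨Metric.ball_subset_closedBall hR1, subset_closure hR2, hPK.2.2.trans hR3⟩)
    have hop : -timeDeriv u P - traceTerm a u P - inner ℝ (b P) (spaceGrad u P) +
      c P * u P ≤ 0 := hLu P hPQ
    have hsum : ∑ i, ∑ j, a P i j * (((-(2 * δ * γ)) • ContinuousLinearMap.id ℝ (Space d))
        (EuclideanSpace.single i 1)) j = -(2 * δ * γ) * ∑ i, a P i i := by
      rw [Finset.mul_sum]
      refine Finset.sum_congr rfl fun i _ => ?_
      simp
      ring
    rw [hsum] at h3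
    rw [h2, inner_neg_right, inner_smul_right] at hop
    linarith
  · set m := τ - 2 * γ * (P.1 - z.1) + inner ℝ (b P) (q - (2 * γ) • (P.2 - z.2)) with hm
    set v : SpaceTime d := (1, b P) with hv
    have hline : HasDerivAt (fun s : ℝ => ψ (P + s • v)) m 0 :=
      hasDerivAt_quadFun_line z q τ γ P (b P)
    have hslope : Tendsto (slope (fun s : ℝ => ψ (P + s • v)) 0) (𝓝[>] 0) (𝓝 m) :=
      (hasDerivAt_iff_tendsto_slope.1 hline).mono_left
        (nhdsWithin_mono _ fun s hs => ne_of_gt hs)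
    -- At a boundary maximum point the step along `(1, b P)` stays in `K`: maximality bounds the
    -- increment of `δψ` by minus that of `u`, and the first-order inequality bounds the latter
    -- below.
    have hle : δ * m ≤ -(c P * u P) := by
      refine le_of_forall_pos_le_add fun ε hε => ?_
      refine le_of_tendsto (hslope.const_mul δ) ?_
      filter_upwards [hL.eventually_le_sub_of_degBoundary hu hLu hPD hε, self_mem_nhdsWithin,
        (tendsto_add_smul_nhdsGT P v).eventually (Metric.isOpen_ball.mem_nhds hPball)]
        with s hs hs0 hsb
      have hs0' : 0 < s := hs0
      have h1 := hmaxK (P + s • v) ⟨Metric.ball_subset_closedBall hsb, subset_closure hs.1, by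
        have := hPK.2.2
        simp only [mem_ofPred_eq] at this
        simp only [mem_ofPred_eq, Prod.fst_add, Prod.smul_fst, hv, smul_eq_mul, mul_one]
        linarith⟩
      have h2 := hs.2
      rw [slope_def_field]
      simp only [zero_smul, add_zero, sub_zero]
      rw [← mul_div_assoc, div_le_iff₀ hs0']
      linarith
    have := mul_pos hδ hθ0
    linarith

/-- Near a zero of `u` on the degenerate boundary there are zeros in the interior at times which
are not smaller. -/
theorem Hypotheses.frequently_eq_zero {Q : Set (SpaceTime d)} {α : ℝ≥0}
    {a : SpaceTime d → Matrix (Fin d) (Fin d) ℝ} {b : SpaceTime d → Space d}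
    {c : SpaceTime d → ℝ} (hL : Hypotheses Q α a b c)
    {u : SpaceTime d → ℝ} (hu : IsC2s Q a u)
    (hLu : ∀ P ∈ Q, parabolicOp a b c u P ≤ 0) {z : SpaceTime d} (hz : z ∈ degBoundary Q a)
    (hneg : ∀ᶠ P in 𝓝 z, P ∈ underlineSet Q a → z.1 ≤ P.1 → u P ≤ 0) (huz : u z = 0) :
    ∃ᶠ P in 𝓝 z, P ∈ Q ∧ z.1 ≤ P.1 ∧ u P = 0 := by
  intro hno
  obtain ⟨n, hn, -, hflat⟩ := hL.exists_normal hz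
  have hzX : z ∈ underlineSet Q a := Or.inr hz
  -- Small enough that tilting the gradient `(0, n)` by at most `2κ` in time and in space keeps its
  -- product with `(1, b)` positive near `z`.
  set κ := inner ℝ (b z) n / (8 * (1 + ‖b z‖)) with hκ
  have hbz : 0 < 1 + ‖b z‖ := by positivity
  have hκ0 : 0 < κ := by positivity
  have hb : ∀ᶠ P in 𝓝 z, P ∈ underlineSet Q a →
      0 < inner ℝ (b P) n - 4 * κ * (1 + ‖b P‖) := by
    have h1 : ContinuousWithinAt (fun P : SpaceTime d => inner ℝ (b P) n -
        4 * κ * (1 + ‖b P‖)) (underlineSet Q a) z :=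
      ((hL.b_continuous z hz).inner continuousWithinAt_const).sub
        (continuousWithinAt_const.mul (continuousWithinAt_const.add (hL.b_continuous z hz).norm))
    refine eventually_nhdsWithin_iff.1 (h1.eventually (lt_mem_nhds ?_))
    have : 4 * κ * (1 + ‖b z‖) = inner ℝ (b z) n / 2 := by
      rw [hκ]; field_simp; norm_num
    simp only [this]
    linarith
  obtain ⟨r, hr, hball⟩ := Metric.nhds_basis_closedBall.eventually_iff.1
    (hb.and (hno.and ((hflat κ hκ0).and (hneg.eventually_nhds.and
      (eventually_mem_underlineSet hL.isOpen hz)))))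
  -- Flatness together with a non-negative value of the paraboloid forces `‖P - z‖ ≤ κ/β = r/2`, so
  -- the maximum point lies in the open ball.
  set β := 2 * κ / r with hβ
  have hβ0 : 0 < β := by positivity
  set K : Set (SpaceTime d) := Metric.closedBall z r ∩ (closure Q ∩ {P | z.1 ≤ P.1}) with hK
  have hKc : IsCompact K := (isCompact_closedBall z r).inter_right
    (isClosed_closure.inter (isClosed_le continuous_const continuous_fst))
  have hKX : K ⊆ underlineSet Q a := fun P hP => (hball hP.1).2.2.2.2 hP.2.1
  have hzK : z ∈ K := ⟨Metric.mem_closedBall_self hr.le, underlineSet_subset_closure hzX, le_refl z.1⟩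
  set F : Set (SpaceTime d) := K ∩ u ⁻¹' {0} with hF
  have hFc : IsCompact F := hKc.of_isClosed_subset
    ((hu.continuousOn.mono hKX).preimage_isClosed_of_isClosed hKc.isClosed isClosed_singleton)
    inter_subset_left
  obtain ⟨P, hPF, hPmax⟩ := hFc.exists_isMaxOn ⟨z, hzK, huz⟩
    (continuous_quadFun z n 0 β).continuousOn
  have hPX := hKX hPF.1
  have hPQ : P ∉ Q := fun h => (hball hPF.1.1).2.1 ⟨h, hPF.1.2.2, hPF.2⟩
  have hPD : P ∈ degBoundary Q a := hPX.resolve_left hPQ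
  have hval : 0 ≤ quadFun z n 0 β P := by
    have h : quadFun z n 0 β z ≤ quadFun z n 0 β P := hPmax ⟨hzK, huz⟩
    simpa [quadFun] using h
  have hfl := (hball hPF.1.1).2.2.1 hPD.1.1
  have hn1 : |P.1 - z.1| ≤ ‖P - z‖ := norm_fst_le (P - z)
  have hn2 : ‖P.2 - z.2‖ ≤ ‖P - z‖ := norm_snd_le (P - z)
  have hsq : ‖P - z‖ ^ 2 ≤ ‖P.2 - z.2‖ ^ 2 + (P.1 - z.1) ^ 2 := by
    rw [Prod.norm_def]
    rcases max_cases ‖(P - z).1‖ ‖(P - z).2‖ with ⟨h, -⟩ | ⟨h, -⟩ <;> rw [h]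
    · rw [Real.norm_eq_abs, sq_abs]
      simp
    · simp [sq_nonneg]
  have hclose : β * ‖P - z‖ ≤ κ := by
    rcases (norm_nonneg (P - z)).eq_or_lt with h0 | h0
    · rw [← h0]; linarith
    · have h1 : β * ‖P - z‖ ^ 2 ≤ κ * ‖P - z‖ := by
        have := mul_le_mul_of_nonneg_left hsq hβ0.le
        have h3 := (le_abs_self _).trans hfl
        simp only [quadFun] at hval
        linarith
      nlinarith
  have hPball : P ∈ Metric.ball z r := by
    rw [Metric.mem_ball, dist_eq_norm]
    have : β * ‖P - z‖ = κ * (2 * ‖P - z‖ / r) := by rw [hβ]; ring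
    rw [this] at hclose
    have h1 : 2 * ‖P - z‖ / r ≤ 1 := by
      by_contra! h
      nlinarith
    rw [div_le_one hr] at h1
    linarith
  set q : Space d := n - (2 * β) • (P.2 - z.2) with hq
  set τ : ℝ := -(2 * β * (P.1 - z.1)) with hτ
  -- Here `(τ, q)` is the gradient of the paraboloid at `P`. Increasing the curvature from `β` to `β
  -- + 1` makes the touching at `P` strict.
  have hexp : ∀ R, quadFun P q τ (β + 1) R = quadFun z n 0 β R - quadFun z n 0 β P -
      (‖R.2 - P.2‖ ^ 2 + (R.1 - P.1) ^ 2) := by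
    intro R
    have e1 : R.2 - z.2 = (R.2 - P.2) + (P.2 - z.2) := by abel
    simp only [quadFun, hq, hτ]
    rw [e1, norm_add_sq_real, inner_add_right, inner_sub_left, inner_smul_left,
      real_inner_comm (R.2 - P.2) (P.2 - z.2)]
    simp only [conj_trivial]
    ring
  have hle := hL.deriv_nonpos_of_touching hu hLu hPD (q := q) (τ := τ) (γ := β + 1)
    (by
      filter_upwards [(hball hPF.1.1).2.2.2.1] with R hR hRX hRt
      exact hR hRX (hPF.1.2.2.trans hRt))
    hPF.2 (by
      filter_upwards [Metric.isOpen_ball.mem_nhds hPball] with R hR hRX hRt hR0 hne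
      have h1 : quadFun z n 0 β R ≤ quadFun z n 0 β P :=
        hPmax ⟨⟨Metric.ball_subset_closedBall hR, underlineSet_subset_closure hRX,
          hPF.1.2.2.trans hRt⟩, hR0⟩
      have h2 : 0 < ‖R.2 - P.2‖ ^ 2 + (R.1 - P.1) ^ 2 := by
        by_contra! h
        have h3 : ‖R.2 - P.2‖ = 0 := by nlinarith [sq_nonneg ‖R.2 - P.2‖, sq_nonneg (R.1 - P.1)]
        have h4 : R.1 - P.1 = 0 := by nlinarith [sq_nonneg ‖R.2 - P.2‖, sq_nonneg (R.1 - P.1)]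
        exact hne (Prod.ext (sub_eq_zero.1 h4) (sub_eq_zero.1 (norm_eq_zero.1 h3)))
      rw [hexp]
      linarith)
  have hbP := (hball hPF.1.1).1 hPX
  rw [hq, inner_sub_right, inner_smul_right] at hle
  have h1 : β * (P.1 - z.1) ≤ κ := by
    have := mul_le_mul_of_nonneg_left ((le_abs_self _).trans hn1) hβ0.le
    linarith
  have h2 : β * inner ℝ (b P) (P.2 - z.2) ≤ κ * ‖b P‖ := by
    have h3 := (real_inner_le_norm (b P) (P.2 - z.2)).trans
      (mul_le_mul_of_nonneg_left hn2 (norm_nonneg _))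
    have h4 := mul_le_mul_of_nonneg_left h3 hβ0.le
    have h5 := mul_le_mul_of_nonneg_right hclose (norm_nonneg (b P))
    linarith
  have h6 : 0 ≤ κ * ‖b P‖ := by positivity
  linarith

/-! ### Propagation of zeros -/

theorem Hypotheses.eq_zero_of_mem_reachSet {Q : Set (SpaceTime d)} {α : ℝ≥0}
    {a : SpaceTime d → Matrix (Fin d) (Fin d) ℝ} {b : SpaceTime d → Space d}
    {c : SpaceTime d → ℝ} (hL : Hypotheses Q α a b c)
    {u : SpaceTime d → ℝ} (hu : IsC2s Q a u)
    (hLu : ∀ P ∈ Q, parabolicOp a b c u P ≤ 0) {P₀ : SpaceTime d}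
    (hP₀ : P₀ ∈ underlineSet Q a) (hS : ∀ P ∈ reachSet (underlineSet Q a) P₀, u P ≤ 0)
    (hu₀ : u P₀ = 0) {P : SpaceTime d} (hP : P ∈ reachSet (underlineSet Q a) P₀) : u P = 0 := by
  have hint : ∀ z ∈ Q, z ∈ reachSet (underlineSet Q a) P₀ → u z = 0 →
      ∀ᶠ P in 𝓝 z, P ∈ Q → z.1 ≤ P.1 → u P = 0 := by
    intro z hz hzS huz
    have hneg : ∀ᶠ P in 𝓝 z, z.1 ≤ P.1 → u P ≤ 0 := by
      obtain ⟨ε, hε, hball⟩ := Metric.isOpen_iff.1 hL.isOpen z hz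
      filter_upwards [Metric.ball_mem_nhds z hε] with P hP ht
      refine hS P (reachSet_trans (reachSet_of_segment ?_ ht) hzS)
      exact (((convex_ball z ε).segment_subset hP (Metric.mem_ball_self hε)).trans hball).trans
        subset_union_left
    filter_upwards [hL.eventually_eq_zero_of_interior_zero hu.isParabolicC2 hLu hz hneg huz]
      with P hP _ ht using hP ht
  refine DegenerateParabolic.eq_zero_of_mem_reachSet (Subset.refl (underlineSet Q a))
    hu.continuousOn ?_ (reachSet_refl hP₀) hu₀ hP
  rintro z (hz | hz) hzS huz
  · have hneg : ∀ᶠ P in 𝓝 z, P ∈ Q := hL.isOpen.mem_nhds hz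
    filter_upwards [hint z hz hzS huz, hneg] with P h1 h2 _ using h1 h2
  obtain ⟨N, hN, hreach⟩ := hL.exists_nhds_reachSet hz
  have hzX : z ∈ underlineSet Q a := Or.inr hz
  have hneg : ∀ᶠ P in 𝓝 z, P ∈ underlineSet Q a → z.1 ≤ P.1 → u P ≤ 0 := by
    filter_upwards [hN] with P hPN hPX ht
    exact hS P (reachSet_trans (hreach _ subset_union_left underlineSet_subset_closure P hPN z
      (mem_of_mem_nhds hN) hPX hzX ht) hzS)
  have hfreq := hL.frequently_eq_zero hu hLu hz hneg huz
  -- An interior zero `y` close to `z` and earlier than `P` is joined to `P` inside `Q`, so interior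
  -- propagation alone reaches `P`.
  have hpos : ∀ P ∈ N, P ∈ Q → z.1 < P.1 → u P = 0 := by
    intro P hPN hPQ ht
    have hNe : ∀ᶠ y in 𝓝 z, y ∈ N := hN
    obtain ⟨y, ⟨hyQ, hyt, hyu⟩, hyN, hyP⟩ := (hfreq.and_eventually
      (hNe.and (continuous_fst.continuousAt.eventually (gt_mem_nhds ht)))).exists
    have hyS : y ∈ reachSet (underlineSet Q a) P₀ :=
      reachSet_trans (hreach _ subset_union_left underlineSet_subset_closure y hyN z
        (mem_of_mem_nhds hN) (Or.inl hyQ) hzX hyt) hzS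
    exact DegenerateParabolic.eq_zero_of_mem_reachSet subset_union_left hu.continuousOn hint hyS
      hyu (hreach Q Subset.rfl subset_closure P hPN y hyN hPQ hyQ hyP.le)
  obtain ⟨n, hn, hcone, -⟩ := hL.exists_normal hz
  -- Points at the same time as `z`, or on the boundary, are limits along this direction of strictly
  -- later points of `Q`.
  set v : SpaceTime d := (1, b z) with hv
  obtain ⟨s₀, hs₀, hs⟩ := hcone v (by rw [real_inner_comm]; exact hn)
  filter_upwards [eventually_mem_nhds_iff.2 hN, hs] with P hPN hPs hPX ht
  have hin : ∀ᶠ s in 𝓝[>] (0 : ℝ), P + s • v ∈ Q := by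
    filter_upwards [Ioc_mem_nhdsGT hs₀] with s hs
    exact hPs (underlineSet_subset_closure hPX) s hs.1 hs.2
  have htend : Tendsto (fun s : ℝ => P + s • v) (𝓝[>] 0) (𝓝[underlineSet Q a] P) :=
    tendsto_nhdsWithin_iff.2 ⟨tendsto_add_smul_nhdsGT P v, hin.mono fun s hs => Or.inl hs⟩
  refine tendsto_nhds_unique ((hu.continuousOn P hPX).tendsto.comp htend)
    (tendsto_const_nhds.congr' ?_)
  filter_upwards [hin, (tendsto_add_smul_nhdsGT P v).eventually hPN, self_mem_nhdsWithin]
    with s hs1 hs2 hs3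
  have hs3' : (0 : ℝ) < s := hs3
  refine (hpos _ hs2 hs1 ?_).symm
  simp only [Prod.fst_add, Prod.smul_fst, hv, smul_eq_mul, mul_one]
  linarith

end DegenerateParabolic

theorem mainTheorem5 {d : ℕ} (hd : 1 ≤ d) (α : ℝ≥0) (hα : 0 < α) (hα1 : α ≤ 1)
    (Q : Set (DegenerateParabolic.SpaceTime d))
    (a : DegenerateParabolic.SpaceTime d → Matrix (Fin d) (Fin d) ℝ)
    (b : DegenerateParabolic.SpaceTime d → DegenerateParabolic.Space d)
    (c : DegenerateParabolic.SpaceTime d → ℝ)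
    (hL : DegenerateParabolic.Hypotheses Q α a b c)
    (u : DegenerateParabolic.SpaceTime d → ℝ)
    (hu : DegenerateParabolic.IsC2s Q a u)
    (hLu : ∀ P ∈ Q, DegenerateParabolic.parabolicOp a b c u P ≤ 0)
    (P₀ : DegenerateParabolic.SpaceTime d)
    (hP₀ : P₀ ∈ DegenerateParabolic.underlineSet Q a)
    (hS : ∀ P ∈ DegenerateParabolic.reachSet (DegenerateParabolic.underlineSet Q a) P₀, u P ≤ 0)
    (hu₀ : u P₀ = 0) :
    ∀ P ∈ DegenerateParabolic.reachSet (DegenerateParabolic.underlineSet Q a) P₀, u P = 0 := by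
  exact fun P hP => hL.eq_zero_of_mem_reachSet hu hLu hP₀ hS hu₀ hP
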